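/- Let $G$ be a (finite-dimensional) Lie group with a bi-invariant Riemannian metric, let $B$ be the corresponding $\mathrm{Ad}$-invariant inner product on the Lie algebra $\mathfrak g=T_eG$, and let $K\subset H\subset G$ be closed connected subgroups with Lie algebras $\mathfrak k\subset\mathfrak h\subset\mathfrak g$. Give $G/K$ its standard manifold structure, for which the projection $\pi:G\to G/K$ is a smooth submersion, and put $o=eK$. Let $\mathfrak m_1=\mathfrak h^{\perp}\cong T_o(G/H)$ and $\mathfrak m_2=\mathfrak h\cap\mathfrak k^{\perp}\cong T_o(H/K)$, orthogonal complements being taken with respect to $B$. Let $\lambda>0$. Then: (i) $d\pi_e$ restricts to a linear isomorphism $\mathfrak m_1\oplus\mathfrak m_2\to T_o(G/K)$, and there is exactly one $G$-invariant Riemannian metric $g_\lambda$ on $G/K$ whose inner product at $o$ corresponds under this isomorphism to $B|_{\mathfrak m_1}+\lambda\,B|_{\mathfrak m_2}$. (ii) $(G/K,g_\lambda)$ is a two-step g.o. space, that is, every geodesic $\gamma$ of $(G/K,g_\lambda)$ with $\gamma(0)=o$ has the form $\gamma(t)=\exp(tX)\exp(tY)\cdot o$ for some $X,Y\in\mathfrak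 g$. More precisely, for all $X_1\in\mathfrak m_1$ and $X_2\in\mathfrak m_2$ the curve $$t\mapsto \exp t(X_1+\lambda X_2)\,\exp t(1-\lambda)X_2\cdot o,\qquad t\in\mathbb R,$$ is a geodesic of $(G/K,g_\lambda)$ through $o$ with initial velocity $d\pi_e(X_1+X_2)$, and every geodesic $\gamma$ with $\gamma(0)=o$ and $\dot\gamma(0)=d\pi_e(X_1+X_2)$, defined on an open interval containing $0$, coincides with this curve on that interval. -/

import Mathlib

open scoped Manifold ContDiff Topology

noncomputable section

namespace TwoStepGO

/-- The velocity vector `γ'(t)` of a curve, as an element of the tangent space at `γ t`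
(every tangent space of `M` is, by definition, a copy of the model space `E`). -/
def velocity (E : Type*) [NormedAddCommGroup E] [NormedSpace ℝ E]
    {M : Type*} [TopologicalSpace M] [ChartedSpace E M] (γ : ℝ → M) (t : ℝ) : E :=
  (mfderiv 𝓘(ℝ, ℝ) 𝓘(ℝ, E) γ t (1 : ℝ) : TangentSpace 𝓘(ℝ, E) (γ t))

theorem velocity_comp_mul {E : Type*} [NormedAddCommGroup E] [NormedSpace ℝ E]
    {M : Type*} [TopologicalSpace M] [ChartedSpace E M] {c : ℝ → M}
    (hc : ContMDiff 𝓘(ℝ, ℝ) 𝓘(ℝ, E) ∞ c) (a : ℝ) :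
    velocity E (fun t => c (a * t)) 0 = a • velocity E c 0 := by
  have h1 : HasMFDerivAt 𝓘(ℝ, ℝ) 𝓘(ℝ, ℝ) (fun t : ℝ => a * t) 0
      (a • ContinuousLinearMap.id ℝ ℝ) :=
    ((hasFDerivAt_id (0 : ℝ)).const_mul a).hasMFDerivAt
  have hcm : MDifferentiableAt 𝓘(ℝ, ℝ) 𝓘(ℝ, E) c (a * 0) := hc.mdifferentiableAt (by simp)
  have key := (hcm.hasMFDerivAt.comp (0 : ℝ) h1).mfderiv
  have h3 := DFunLike.congr_fun key (1 : ℝ)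
  unfold velocity
  refine h3.trans ?_
  have h4 := (mfderiv 𝓘(ℝ, ℝ) 𝓘(ℝ, E) c (a * 0)).map_smul a (1 : ℝ)
  have h5 : (mfderiv 𝓘(ℝ, ℝ) 𝓘(ℝ, E) c (a * 0) (1 : ℝ) : E)
      = mfderiv 𝓘(ℝ, ℝ) 𝓘(ℝ, E) c 0 (1 : ℝ) := by rw [mul_zero]
  exact h4.trans (congrArg (fun v : E => a • v) h5)

section Riemannian

variable {E : Type*} [NormedAddCommGroup E] [NormedSpace ℝ E]
  {M : Type*} [TopologicalSpace M] [ChartedSpace E M] [IsManifold 𝓘(ℝ, E) ∞ M]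

variable (E M) in
/-- Smooth Riemannian metrics on a smooth manifold `M` without boundary, modelled on the
vector space `E`. -/
abbrev SmoothMetric : Type _ :=
  Bundle.ContMDiffRiemannianMetric 𝓘(ℝ, E) ∞ E (fun x : M => TangentSpace 𝓘(ℝ, E) x)

/-- The metric coefficients `g_{uv}` in the preferred chart `φ` around `p`:
`x ↦ g_{φ⁻¹ x} (dφ⁻¹ u, dφ⁻¹ v)`, where `x` ranges over the target of the chart. -/
def chartMetric (g : SmoothMetric E M) (p : M) (x u v : E) : ℝ :=
  g.inner ((extChartAt 𝓘(ℝ, E) p).symm x)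
    (mfderiv 𝓘(ℝ, E) 𝓘(ℝ, E) (extChartAt 𝓘(ℝ, E) p).symm x u)
    (mfderiv 𝓘(ℝ, E) 𝓘(ℝ, E) (extChartAt 𝓘(ℝ, E) p).symm x v)

/-- The Christoffel symbol of the first kind of the metric `g` in the chart around `p`,
contracted twice with `u` and once with `w`:
`[ij,k] u^i u^j w^k = ½ (∂_i g_jk + ∂_j g_ik - ∂_k g_ij) u^i u^j w^k
  = D_u g (u, w) - ½ D_w g (u, u)`. -/
def chartChristoffel (g : SmoothMetric E M) (p : M) (x u w : E) : ℝ :=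
  fderiv ℝ (fun y => chartMetric g p y u w) x u
    - (1 / 2) * fderiv ℝ (fun y => chartMetric g p y u u) x w

/-- The curve `γ` is a geodesic on the open set `J` of times: it is smooth there, and in every
preferred chart its coordinate expression `c` satisfies `∇_{c'} c' = 0`, which, lowering the index
with the nondegenerate metric, reads `g (c'', w) + [ij,k] c'^i c'^j w^k = 0` for all `w`. -/
def IsGeodesicOn (g : SmoothMetric E M) (γ : ℝ → M) (J : Set ℝ) : Prop :=
  ContMDiffOn 𝓘(ℝ, ℝ) 𝓘(ℝ, E) ∞ γ J ∧
    ∀ t ∈ J, ∀ p : M, γ t ∈ (chartAt E p).source →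
      let c : ℝ → E := fun s => extChartAt 𝓘(ℝ, E) p (γ s)
      ∀ w : E, chartMetric g p (c t) (deriv (deriv c) t) w
        + chartChristoffel g p (c t) (deriv c t) w = 0

/-- The group `G` acts on `M` by isometries of the metric `g`. -/
def IsInvariantMetric (G : Type*) [SMul G M] (g : SmoothMetric E M) : Prop :=
  ∀ (a : G) (p : M) (u v : TangentSpace 𝓘(ℝ, E) p),
    g.inner (a • p) (mfderiv 𝓘(ℝ, E) 𝓘(ℝ, E) (fun q : M => a • q) p u)
      (mfderiv 𝓘(ℝ, E) 𝓘(ℝ, E) (fun q : M => a • q) p v) = g.inner p u v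

end Riemannian

section LieGroups

variable {E : Type*} [NormedAddCommGroup E] [NormedSpace ℝ E]
  {G : Type*} [TopologicalSpace G] [ChartedSpace E G] [Group G]

/-- The exponential map of a Lie group: `exp X = φ 1`, where `φ` is the integral curve through
the identity of the left-invariant vector field with value `X` at the identity, that is, the
one-parameter subgroup of `G` generated by `X`. -/
def lieExp (X : GroupLieAlgebra 𝓘(ℝ, E) G) : G :=
  haveI : Nonempty (ℝ → G) := ⟨fun _ => 1⟩
  Classical.epsilon
    (fun φ : ℝ → G => φ 0 = 1 ∧ IsMIntegralCurve φ (mulInvariantVectorField X)) 1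

/-- A Riemannian metric on `G` for which all left and all right translations are isometries. -/
def IsBiInvariant [LieGroup 𝓘(ℝ, E) ∞ G] (b : SmoothMetric E G) : Prop :=
  (∀ (a x : G) (u v : TangentSpace 𝓘(ℝ, E) x),
    b.inner (a * x) (mfderiv 𝓘(ℝ, E) 𝓘(ℝ, E) (fun y : G => a * y) x u)
      (mfderiv 𝓘(ℝ, E) 𝓘(ℝ, E) (fun y : G => a * y) x v) = b.inner x u v) ∧
  (∀ (a x : G) (u v : TangentSpace 𝓘(ℝ, E) x),
    b.inner (x * a) (mfderiv 𝓘(ℝ, E) 𝓘(ℝ, E) (fun y : G => y * a) x u)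
      (mfderiv 𝓘(ℝ, E) 𝓘(ℝ, E) (fun y : G => y * a) x v) = b.inner x u v)

theorem velocity_mul [LieGroup 𝓘(ℝ, E) ∞ G] {c d : ℝ → G}
    (hc : ContMDiff 𝓘(ℝ, ℝ) 𝓘(ℝ, E) ∞ c) (hd : ContMDiff 𝓘(ℝ, ℝ) 𝓘(ℝ, E) ∞ d)
    (hc0 : c 0 = 1) (hd0 : d 0 = 1) :
    velocity E (fun t => c t * d t) 0 = velocity E c 0 + velocity E d 0 := by
  have hcm : MDifferentiableAt 𝓘(ℝ, ℝ) 𝓘(ℝ, E) c 0 := hc.mdifferentiableAt (by simp)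
  have hdm : MDifferentiableAt 𝓘(ℝ, ℝ) 𝓘(ℝ, E) d 0 := hd.mdifferentiableAt (by simp)
  have hm : ContMDiff (𝓘(ℝ, ℝ).prod 𝓘(ℝ, ℝ)) 𝓘(ℝ, E) ∞ (fun p : ℝ × ℝ => c p.1 * d p.2) :=
    (hc.comp contMDiff_fst).mul (hd.comp contMDiff_snd)
  have hmd : MDifferentiableAt (𝓘(ℝ, ℝ).prod 𝓘(ℝ, ℝ)) 𝓘(ℝ, E)
      (fun p : ℝ × ℝ => c p.1 * d p.2) ((fun t : ℝ => (t, t)) 0) :=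
    hm.mdifferentiableAt (by simp)
  have hdiag : HasMFDerivAt 𝓘(ℝ, ℝ) (𝓘(ℝ, ℝ).prod 𝓘(ℝ, ℝ)) (fun t : ℝ => (t, t)) 0
      ((ContinuousLinearMap.id ℝ ℝ).prod (ContinuousLinearMap.id ℝ ℝ)) :=
    (hasMFDerivAt_id (0 : ℝ)).prodMk (hasMFDerivAt_id (0 : ℝ))
  have key := (HasMFDerivAt.comp (f := fun t : ℝ => (t, t))
    (g := fun p : ℝ × ℝ => c p.1 * d p.2) (0 : ℝ) hmd.hasMFDerivAt hdiag).mfderiv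
  have h2 := mfderiv_prod_eq_add_apply (v := ((1 : ℝ), (1 : ℝ))) hmd
  have e1 : velocity E (fun z : ℝ => c z * d 0) 0 = velocity E c 0 := by
    have : (fun z : ℝ => c z * d 0) = c := by funext z; rw [hd0, mul_one]
    rw [this]
  have e2 : velocity E (fun z : ℝ => c 0 * d z) 0 = velocity E d 0 := by
    have : (fun z : ℝ => c 0 * d z) = d := by funext z; rw [hc0, one_mul]
    rw [this]
  have h3 : velocity E (fun t => c t * d t) 0
      = velocity E (fun z : ℝ => c z * d 0) 0 + velocity E (fun z : ℝ => c 0 * d z) 0 :=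
    (DFunLike.congr_fun key (1 : ℝ)).trans h2
  rw [h3, e1, e2]

/-- The Lie algebra `T_e K ⊆ T_e G` of a closed subgroup `K` of the Lie group `G`: the velocity
vectors at the identity of the smooth curves of `G` that start at the identity and stay
in `K`. -/
def lieAlgebraOf [LieGroup 𝓘(ℝ, E) ∞ G] (K : Subgroup G) :
    Submodule ℝ (GroupLieAlgebra 𝓘(ℝ, E) G) where
  carrier := {X | ∃ c : ℝ → G, ContMDiff 𝓘(ℝ, ℝ) 𝓘(ℝ, E) ∞ c ∧ (∀ t, c t ∈ K) ∧ c 0 = 1 ∧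
    velocity E c 0 = X}
  add_mem' := by
    rintro X Y ⟨c, hc, hcK, hc0, hcX⟩ ⟨d, hd, hdK, hd0, hdY⟩
    refine ⟨fun t => c t * d t, hc.mul hd, fun t => K.mul_mem (hcK t) (hdK t),
      by simp [hc0, hd0], ?_⟩
    rw [velocity_mul hc hd hc0 hd0, hcX, hdY]
    rfl
  zero_mem' := by
    refine ⟨fun _ => 1, contMDiff_const, fun _ => K.one_mem, rfl, ?_⟩
    unfold velocity
    rw [mfderiv_const]
    rfl
  smul_mem' := by
    rintro a X ⟨c, hc, hcK, hc0, hcX⟩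
    refine ⟨fun t => c (a * t), hc.comp (contDiff_const.mul contDiff_id).contMDiff,
      fun t => hcK _, by simp [hc0], ?_⟩
    rw [velocity_comp_mul hc a, hcX]
    rfl

/-- The orthogonal complement of a subspace of the Lie algebra, with respect to the inner product
`B = b_e` on `T_e G` given by a Riemannian metric `b` on `G`. -/
def orthCompl [LieGroup 𝓘(ℝ, E) ∞ G] (b : SmoothMetric E G)
    (V : Submodule ℝ (GroupLieAlgebra 𝓘(ℝ, E) G)) :
    Submodule ℝ (GroupLieAlgebra 𝓘(ℝ, E) G) where
  carrier := {X | ∀ Y ∈ V, b.inner 1 X Y = 0}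
  add_mem' := by
    intro X X' hX hX' Y hY
    rw [map_add, _root_.add_apply, hX Y hY, hX' Y hY, add_zero]
  zero_mem' := by
    intro Y _
    rw [map_zero, _root_.zero_apply]
  smul_mem' := by
    intro a X hX Y hY
    rw [map_smul, _root_.smul_apply, hX Y hY, smul_zero]

/-- The subspace `𝔪₁ = 𝔥^⊥` of `𝔤`, identified with the tangent space of `G/H` at the origin. -/
def mOne [LieGroup 𝓘(ℝ, E) ∞ G] (b : SmoothMetric E G) (H : Subgroup G) :
    Submodule ℝ (GroupLieAlgebra 𝓘(ℝ, E) G) :=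
  orthCompl b (lieAlgebraOf H)

/-- The subspace `𝔪₂ = 𝔥 ∩ 𝔨^⊥` of `𝔤`, identified with the tangent space of `H/K` at the
origin. -/
def mTwo [LieGroup 𝓘(ℝ, E) ∞ G] (b : SmoothMetric E G) (K H : Subgroup G) :
    Submodule ℝ (GroupLieAlgebra 𝓘(ℝ, E) G) :=
  lieAlgebraOf H ⊓ orthCompl b (lieAlgebraOf K)

variable {E' : Type*} [NormedAddCommGroup E'] [NormedSpace ℝ E']

/-- The differential at the identity of the projection `π : G → G/K`, as a map from the Lie
algebra of `G` to the tangent space of `G/K` at the origin `o = eK`. -/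
def dProj (E' : Type*) [NormedAddCommGroup E'] [NormedSpace ℝ E'] (K : Subgroup G)
    [ChartedSpace E' (G ⧸ K)] :
    GroupLieAlgebra 𝓘(ℝ, E) G →L[ℝ] TangentSpace 𝓘(ℝ, E') (QuotientGroup.mk 1 : G ⧸ K) :=
  mfderiv 𝓘(ℝ, E) 𝓘(ℝ, E') (QuotientGroup.mk : G → G ⧸ K) 1

/-- `g` is the `G`-invariant Riemannian metric on `G/K` which at the origin is the inner product
`B|_{𝔪₁} + lam B|_{𝔪₂}` on `𝔪₁ ⊕ 𝔪₂ ≅ T_o(G/K)`. -/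
def IsDeformedMetric [LieGroup 𝓘(ℝ, E) ∞ G] (b : SmoothMetric E G) (K H : Subgroup G)
    [ChartedSpace E' (G ⧸ K)] [IsManifold 𝓘(ℝ, E') ∞ (G ⧸ K)] (lam : ℝ)
    (g : SmoothMetric E' (G ⧸ K)) : Prop :=
  IsInvariantMetric G g ∧
    ∀ X₁ ∈ mOne b H, ∀ X₂ ∈ mTwo b K H, ∀ Y₁ ∈ mOne b H, ∀ Y₂ ∈ mTwo b K H,
      g.inner (QuotientGroup.mk 1 : G ⧸ K) (dProj E' K (X₁ + X₂)) (dProj E' K (Y₁ + Y₂))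
        = b.inner 1 X₁ Y₁ + lam * b.inner 1 X₂ Y₂

/-- The curve `t ↦ exp(tX) exp(tY) · o` in `G/K`. -/
def twoStepCurve (K : Subgroup G) (X Y : GroupLieAlgebra 𝓘(ℝ, E) G) (t : ℝ) : G ⧸ K :=
  (lieExp (t • X) * lieExp (t • Y)) • (QuotientGroup.mk 1 : G ⧸ K)

/-- `(G/K, g)` is a two-step g.o. space: every geodesic `γ` through the origin, defined on an
arbitrary open interval of times containing `0`, is of the form `γ t = exp(tX) exp(tY) · o`. -/
def IsTwoStepGOSpace (E : Type*) [NormedAddCommGroup E] [NormedSpace ℝ E]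
    {G : Type*} [TopologicalSpace G] [ChartedSpace E G] [Group G] (K : Subgroup G)
    [ChartedSpace E' (G ⧸ K)] [IsManifold 𝓘(ℝ, E') ∞ (G ⧸ K)]
    (g : SmoothMetric E' (G ⧸ K)) : Prop :=
  ∀ (J : Set ℝ) (γ : ℝ → G ⧸ K), IsOpen J → J.OrdConnected → (0 : ℝ) ∈ J →
    IsGeodesicOn g γ J → γ 0 = QuotientGroup.mk 1 →
    ∃ X Y : GroupLieAlgebra 𝓘(ℝ, E) G, ∀ t ∈ J, γ t = twoStepCurve K X Y t

end LieGroups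

end TwoStepGO

end

/-! The proof is Noether's theorem run backwards. Let `g` be a `G`-invariant metric on `G/K` and,
for `Z` in the Lie algebra, let `Z*` be the fundamental field of the action. If the momentum `g(γ',
Z*)` is constant along a curve `γ` for every `Z`, then `γ` is a geodesic. Indeed, the variation
`exp(sZ) • γ(t)` consists of isometric copies of `γ`, so its speed does not depend on `s`; combined
with the constant momentum, the first variation formula (`first_variation`) gives the geodesic
equation tested against `Z*`. The action is transitive, so the fundamental fields span each tangent
space, and this is `isGeodesicOn_of_momentum_const`.

For the curve `exp(tA) exp(tC) · o` with `A = X₁ + λX₂` and `C = (1-λ)X₂`, write `c = exp(tA)` and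
`d = exp(tC)`. Its left logarithmic derivative is `Ad(d⁻¹)A + C = Ad(d⁻¹)X₁ + X₂`, because `Ad(d)`
fixes `X₂` and `λ + (1-λ) = 1`. Moreover `Ad(d⁻¹)X₁` stays in `𝔪₁`, since `C ∈ 𝔥` and `B` is
`Ad`-invariant (`Ad_lieExp_mem_orthCompl`). The deformed form paired with this vector is therefore
`B` paired with `Ad(d⁻¹)X₁ + λX₂ = Ad(d⁻¹)A`. The momentum along `Z` is `B(Ad(d⁻¹)A, Ad((cd)⁻¹)Z) =
B(Ad(c)A, Z) = B(A, Z)`, which is independent of `t` (`momentum_twoStepCurve`).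

Every other geodesic from `o` is identified with one of these by uniqueness for the geodesic
equation (`IsGeodesicOn.eqOn`), as `dπ` maps `𝔪₁ ⊕ 𝔪₂` isomorphically onto `T_o(G/K)`. The metric
itself is an `Ad(K)`-invariant inner product at `o`, spread by translations; smooth local sections
of the submersion `π` give its smoothness. -/

noncomputable section

namespace TwoStepGO

/-! ### Derivatives and velocities as maps between model spaces -/

section Calculus

variable (E : Type*) [NormedAddCommGroup E] [NormedSpace ℝ E]
  (F : Type*) [NormedAddCommGroup F] [NormedSpace ℝ F]
  (F' : Type*) [NormedAddCommGroup F'] [NormedSpace ℝ F']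
  {M : Type*} [TopologicalSpace M] [ChartedSpace E M]
  {N : Type*} [TopologicalSpace N] [ChartedSpace F N]
  {P : Type*} [TopologicalSpace P] [ChartedSpace F' P]

/-- The derivative of a map between manifolds, as a map between the model spaces. -/
def tder (f : M → N) (x : M) : E →L[ℝ] F := mfderiv 𝓘(ℝ, E) 𝓘(ℝ, F) f x

theorem velocity_eq_tder (γ : ℝ → M) (t : ℝ) : velocity E γ t = tder ℝ E γ t 1 := rfl

variable {E F F'}

theorem tder_comp {g : N → P} {f : M → N} {x : M} {y : N}
    (hg : MDifferentiableAt 𝓘(ℝ, F) 𝓘(ℝ, F') g y) (hf : MDifferentiableAt 𝓘(ℝ, E) 𝓘(ℝ, F) f x)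
    (hy : f x = y) :
    tder E F' (fun z => g (f z)) x = (tder F F' g y).comp (tder E F f x) := by
  subst hy
  exact mfderiv_comp x hg hf

theorem tder_congr {f g : M → N} {x : M} (h : f =ᶠ[𝓝 x] g) : tder E F f x = tder E F g x :=
  h.mfderiv_eq

theorem tder_id (x : M) : tder E E (fun y : M => y) x = ContinuousLinearMap.id ℝ E :=
  mfderiv_id

theorem tder_const (x : M) (c : N) : tder E F (fun _ : M => c) x = 0 :=
  mfderiv_const

theorem tder_eq_fderiv (f : E → F) (x : E) : tder E F f x = fderiv ℝ f x :=
  mfderiv_eq_fderiv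

theorem velocity_eq_deriv (f : ℝ → F) (t : ℝ) : velocity F f t = deriv f t := by
  rw [velocity_eq_tder, tder_eq_fderiv]; simp

theorem velocity_comp {f : M → N} {γ : ℝ → M} {t : ℝ} {y : M}
    (hf : MDifferentiableAt 𝓘(ℝ, E) 𝓘(ℝ, F) f y)
    (hγ : MDifferentiableAt 𝓘(ℝ, ℝ) 𝓘(ℝ, E) γ t) (hy : γ t = y) :
    velocity F (fun s => f (γ s)) t = tder E F f y (velocity E γ t) := by
  rw [velocity_eq_tder, tder_comp hf hγ hy]; rfl

theorem velocity_comp₂ {f : M → N → P} {c : ℝ → M} {d : ℝ → N} {t : ℝ}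
    (hf : MDifferentiableAt (𝓘(ℝ, E).prod 𝓘(ℝ, F)) 𝓘(ℝ, F') (fun p : M × N => f p.1 p.2)
      (c t, d t))
    (hc : MDifferentiableAt 𝓘(ℝ, ℝ) 𝓘(ℝ, E) c t) (hd : MDifferentiableAt 𝓘(ℝ, ℝ) 𝓘(ℝ, F) d t) :
    velocity F' (fun s => f (c s) (d s)) t
      = tder E F' (fun x => f x (d t)) (c t) (velocity E c t)
        + tder F F' (fun y => f (c t) y) (d t) (velocity F d t) := by
  have hcd : HasMFDerivAt 𝓘(ℝ, ℝ) (𝓘(ℝ, E).prod 𝓘(ℝ, F)) (fun s => (c s, d s)) t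
      ((mfderiv 𝓘(ℝ, ℝ) 𝓘(ℝ, E) c t).prod (mfderiv 𝓘(ℝ, ℝ) 𝓘(ℝ, F) d t)) :=
    hc.hasMFDerivAt.prodMk hd.hasMFDerivAt
  have key := (HasMFDerivAt.comp (f := fun s => (c s, d s))
    (g := fun p : M × N => f p.1 p.2) t hf.hasMFDerivAt hcd).mfderiv
  exact (DFunLike.congr_fun key (1 : ℝ)).trans (mfderiv_prod_eq_add_apply
    (v := (velocity E c t, velocity F d t)) hf)

section Charts

variable [IsManifold 𝓘(ℝ, E) ∞ M] [IsManifold 𝓘(ℝ, F) ∞ N]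

theorem contMDiffAt_extChart {p q : M} (hq : q ∈ (chartAt E p).source) :
    ContMDiffAt 𝓘(ℝ, E) 𝓘(ℝ, E) ∞ (extChartAt 𝓘(ℝ, E) p) q :=
  contMDiffAt_extChartAt' hq

theorem contMDiffAt_extChart_symm {p : M} {x : E} (hx : x ∈ (extChartAt 𝓘(ℝ, E) p).target) :
    ContMDiffAt 𝓘(ℝ, E) 𝓘(ℝ, E) ∞ (extChartAt 𝓘(ℝ, E) p).symm x :=
  (contMDiffOn_extChartAt_symm p).contMDiffAt ((isOpen_extChartAt_target p).mem_nhds hx)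

theorem tder_extChart_symm_comp {p q : M} (hq : q ∈ (chartAt E p).source) :
    (tder E E (extChartAt 𝓘(ℝ, E) p).symm (extChartAt 𝓘(ℝ, E) p q)).comp
      (tder E E (extChartAt 𝓘(ℝ, E) p) q) = ContinuousLinearMap.id ℝ E := by
  have hq' : q ∈ (extChartAt 𝓘(ℝ, E) p).source := by simpa using hq
  rw [← tder_comp ((contMDiffAt_extChart_symm
    ((extChartAt 𝓘(ℝ, E) p).map_source hq')).mdifferentiableAt (by simp))
    ((contMDiffAt_extChart hq).mdifferentiableAt (by simp)) rfl, ← tder_id q]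
  refine tder_congr ?_
  filter_upwards [(chartAt E p).open_source.mem_nhds hq] with z hz
  exact (extChartAt 𝓘(ℝ, E) p).left_inv (by simpa using hz)

theorem tder_extChart_comp_symm {p : M} {x : E} (hx : x ∈ (extChartAt 𝓘(ℝ, E) p).target) :
    (tder E E (extChartAt 𝓘(ℝ, E) p) ((extChartAt 𝓘(ℝ, E) p).symm x)).comp
      (tder E E (extChartAt 𝓘(ℝ, E) p).symm x) = ContinuousLinearMap.id ℝ E := by
  have hq' : (extChartAt 𝓘(ℝ, E) p).symm x ∈ (chartAt E p).source := by
    simpa using (extChartAt 𝓘(ℝ, E) p).map_target hx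
  rw [← tder_comp ((contMDiffAt_extChart hq').mdifferentiableAt (by simp))
    ((contMDiffAt_extChart_symm hx).mdifferentiableAt (by simp)) rfl, ← tder_id x]
  refine tder_congr ?_
  filter_upwards [(isOpen_extChartAt_target p).mem_nhds hx] with z hz
  exact (extChartAt 𝓘(ℝ, E) p).right_inv hz

/-- The tangent space at `p` is read in the preferred chart at `p`, so there the chart
differentiates to the identity. -/
theorem tder_extChart_self (p : M) :
    tder E E (extChartAt 𝓘(ℝ, E) p) p = ContinuousLinearMap.id ℝ E :=
  mfderiv_extChartAt_self

theorem tder_extChart_symm_self (p : M) :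
    tder E E (extChartAt 𝓘(ℝ, E) p).symm (extChartAt 𝓘(ℝ, E) p p)
      = ContinuousLinearMap.id ℝ E := by
  have h := tder_extChart_symm_comp (mem_chart_source E p)
  rwa [tder_extChart_self, ContinuousLinearMap.comp_id] at h

/-- The partial derivative of a smooth map depending on parameters is smooth, when expressed in
charts. -/
theorem contMDiffAt_tder_param
    {EP : Type*} [NormedAddCommGroup EP] [NormedSpace ℝ EP]
    {Q : Type*} [TopologicalSpace Q] [ChartedSpace EP Q] [IsManifold 𝓘(ℝ, EP) ∞ Q]
    {f : Q → M → N} {g : Q → M} {q₀ : Q}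
    (hf : ContMDiffAt (𝓘(ℝ, EP).prod 𝓘(ℝ, E)) 𝓘(ℝ, F) ∞ (fun p : Q × M => f p.1 p.2) (q₀, g q₀))
    (hg : ContMDiffAt 𝓘(ℝ, EP) 𝓘(ℝ, E) ∞ g q₀) :
    ContMDiffAt 𝓘(ℝ, EP) 𝓘(ℝ, E →L[ℝ] F) ∞
      (fun q => (tder F F (extChartAt 𝓘(ℝ, F) (f q₀ (g q₀))) (f q (g q))).comp
        ((tder E F (f q) (g q)).comp
          (tder E E (extChartAt 𝓘(ℝ, E) (g q₀)).symm (extChartAt 𝓘(ℝ, E) (g q₀) (g q))))) q₀ := by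
  -- This gives smoothness in tangent coordinates; near `q₀` these amount to composing with the
  -- derivatives of the two preferred charts.
  have h := ContMDiffAt.mfderiv (m := ∞) f g hf hg (by simp)
  refine h.congr_of_eventuallyEq ?_
  have hfg : ContinuousAt (fun q => f q (g q)) q₀ :=
    ContinuousAt.comp (f := fun q => (q, g q)) (x := q₀) hf.continuousAt
      (continuousAt_id.prodMk hg.continuousAt)
  filter_upwards [hg.continuousAt.preimage_mem_nhds
    ((chartAt E (g q₀)).open_source.mem_nhds (mem_chart_source E (g q₀))),
    hfg.preimage_mem_nhds ((chartAt F (f q₀ (g q₀))).open_source.mem_nhds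
      (mem_chart_source F (f q₀ (g q₀))))] with q h1 h2
  refine Eq.trans ?_ (inTangentCoordinates_eq_mfderiv_comp h1 h2).symm
  simp only [tder, modelWithCornersSelf_coe, Set.range_id, mfderivWithin_univ]
  rfl

end Charts

end Calculus

end TwoStepGO

end

noncomputable section

namespace TwoStepGO

/-! ### Metrics as smooth form-valued functions in charts -/

section MetricCharts

variable {E : Type*} [NormedAddCommGroup E] [NormedSpace ℝ E]
  {F : Type*} [NormedAddCommGroup F] [NormedSpace ℝ F]
  {M : Type*} [TopologicalSpace M] [ChartedSpace E M]
  {N : Type*} [TopologicalSpace N] [ChartedSpace F N]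

/-- The pullback of a bilinear form. -/
def pullForm (B : F →L[ℝ] F →L[ℝ] ℝ) (A : E →L[ℝ] F) : E →L[ℝ] E →L[ℝ] ℝ := B.bilinearComp A A

@[simp]
theorem pullForm_apply (B : F →L[ℝ] F →L[ℝ] ℝ) (A : E →L[ℝ] F) (u v : E) :
    pullForm B A u v = B (A u) (A v) := rfl

theorem contDiff_flip : ContDiff ℝ ∞ (fun f : E →L[ℝ] F →L[ℝ] ℝ => f.flip) :=
  ContinuousLinearMap.contDiff (E := E →L[ℝ] F →L[ℝ] ℝ) (F := F →L[ℝ] E →L[ℝ] ℝ)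
    ((ContinuousLinearMap.flipₗᵢ ℝ E F ℝ).toContinuousLinearEquiv : _ →L[ℝ] _)

theorem contDiff_pullForm :
    ContDiff ℝ ∞ (fun p : (F →L[ℝ] F →L[ℝ] ℝ) × (E →L[ℝ] F) => pullForm p.1 p.2) := by
  have h1 : ContDiff ℝ ∞ (fun p : (F →L[ℝ] F →L[ℝ] ℝ) × (E →L[ℝ] F) => p.1.comp p.2) :=
    contDiff_fst.clm_comp contDiff_snd
  exact contDiff_flip.comp ((contDiff_flip.comp h1).clm_comp contDiff_snd)

theorem ContMDiffAt.pullForm {b : N → F →L[ℝ] F →L[ℝ] ℝ} {A : N → E →L[ℝ] F} {q : N}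
    (hb : ContMDiffAt 𝓘(ℝ, F) 𝓘(ℝ, F →L[ℝ] F →L[ℝ] ℝ) ∞ b q)
    (hA : ContMDiffAt 𝓘(ℝ, F) 𝓘(ℝ, E →L[ℝ] F) ∞ A q) :
    ContMDiffAt 𝓘(ℝ, F) 𝓘(ℝ, E →L[ℝ] E →L[ℝ] ℝ) ∞
      (fun x => TwoStepGO.pullForm (b x) (A x)) q :=
  contDiff_pullForm.contMDiff.contMDiffAt.comp (f := fun x => (b x, A x)) q (hb.prodMk_space hA)

variable [IsManifold 𝓘(ℝ, E) ∞ M]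

/-- The trivialisation of the tangent bundle at `q₀` is inverted by the derivative of the inverse
chart, and the scalar target is a trivial bundle. -/
theorem inCoordinates_bilin_section
    (m : ∀ q : M, TangentSpace 𝓘(ℝ, E) q →L[ℝ] TangentSpace 𝓘(ℝ, E) q →L[ℝ] ℝ) {q₀ q : M}
    (hq : q ∈ (chartAt E q₀).source) :
    ContinuousLinearMap.inCoordinates E (TangentSpace 𝓘(ℝ, E) : M → Type _) (E →L[ℝ] ℝ)
      (fun q : M => TangentSpace 𝓘(ℝ, E) q →L[ℝ] ℝ) q₀ q q₀ q (m q)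
      = pullForm (F := E) (m q : E →L[ℝ] E →L[ℝ] ℝ)
        (tder E E (extChartAt 𝓘(ℝ, E) q₀).symm (extChartAt 𝓘(ℝ, E) q₀ q)) := by
  have e := TangentBundle.symmL_trivializationAt (I := 𝓘(ℝ, E)) hq
  have e' : ∀ u : E, (trivializationAt E (TangentSpace 𝓘(ℝ, E)) q₀).symm q u
      = tder E E (extChartAt 𝓘(ℝ, E) q₀).symm (extChartAt 𝓘(ℝ, E) q₀ q) u := by
    intro u
    refine Eq.trans ?_ ((DFunLike.congr_fun e u).trans ?_)
    · exact (Bundle.Trivialization.symmL_apply _ (by simpa using hq) u).symm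
    simp only [tder, modelWithCornersSelf_coe, Set.range_id, mfderivWithin_univ]
    rfl
  ext u v
  refine (inCoordinates_apply_eq₂ (E₃ := Bundle.Trivial M ℝ) (by simpa using hq) (by simpa using hq)
    (Set.mem_univ _)).trans ?_
  have ht : ∀ r : ℝ, (trivializationAt ℝ (Bundle.Trivial M ℝ) q₀).linearMapAt ℝ q r = r := by
    intro r
    simp
  refine (ht _).trans ?_
  exact congrArg₂ (fun a b : E => (m q : E →L[ℝ] E →L[ℝ] ℝ) a b) (e' u) (e' v)

/-- A section of the bundle of bilinear forms on the tangent bundle is smooth if and only if its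
expression in the preferred chart is. -/
theorem contMDiffAt_bilin_section_iff
    (m : ∀ q : M, TangentSpace 𝓘(ℝ, E) q →L[ℝ] TangentSpace 𝓘(ℝ, E) q →L[ℝ] ℝ) (q₀ : M) :
    ContMDiffAt 𝓘(ℝ, E) (𝓘(ℝ, E).prod 𝓘(ℝ, E →L[ℝ] E →L[ℝ] ℝ)) ∞
      (fun q : M => Bundle.TotalSpace.mk' (E →L[ℝ] E →L[ℝ] ℝ) q (m q)) q₀ ↔
    ContMDiffAt 𝓘(ℝ, E) 𝓘(ℝ, E →L[ℝ] E →L[ℝ] ℝ) ∞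
      (fun q => pullForm (F := E) (m q : E →L[ℝ] E →L[ℝ] ℝ)
        (tder E E (extChartAt 𝓘(ℝ, E) q₀).symm (extChartAt 𝓘(ℝ, E) q₀ q))) q₀ := by
  refine (contMDiffAt_hom_bundle _).trans ?_
  have hev : ∀ᶠ q in 𝓝 q₀, q ∈ (chartAt E q₀).source :=
    (chartAt E q₀).open_source.mem_nhds (mem_chart_source E q₀)
  constructor
  · intro h
    refine h.2.congr_of_eventuallyEq ?_
    exact hev.mono fun q hq => (inCoordinates_bilin_section m hq).symm
  · intro h
    refine ⟨contMDiffAt_id, ?_⟩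
    refine h.congr_of_eventuallyEq ?_
    exact hev.mono fun q hq => inCoordinates_bilin_section m hq

variable (g : SmoothMetric E M) (p : M)

/-- The inner product of the metric at a point, as a bilinear form on the model space. -/
def metForm (q : M) : E →L[ℝ] E →L[ℝ] ℝ := g.inner q

theorem metForm_symm (q : M) (u v : E) : metForm g q u v = metForm g q v u := g.symm q u v

theorem metForm_pos (q : M) {u : E} (hu : u ≠ 0) : 0 < metForm g q u u := g.pos q u hu

/-- The metric in the preferred chart around `p`, as a function with values in bilinear forms. -/
def chartForm (x : E) : E →L[ℝ] E →L[ℝ] ℝ :=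
  pullForm (metForm g ((extChartAt 𝓘(ℝ, E) p).symm x))
    (tder E E (extChartAt 𝓘(ℝ, E) p).symm x)

theorem chartMetric_eq (x u v : E) : chartMetric g p x u v = chartForm g p x u v := rfl

theorem chartForm_symm (x u v : E) : chartForm g p x u v = chartForm g p x v u :=
  metForm_symm _ _ _ _

variable {p}

theorem chartForm_pos {x : E} (hx : x ∈ (extChartAt 𝓘(ℝ, E) p).target) {u : E} (hu : u ≠ 0) :
    0 < chartForm g p x u u := by
  refine metForm_pos g _ fun (h : tder E E _ x u = 0) => hu ?_
  have := DFunLike.congr_fun (tder_extChart_comp_symm hx) u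
  rw [ContinuousLinearMap.comp_apply, h, map_zero] at this
  exact this.symm

theorem chartForm_extChart {q : M} (hq : q ∈ (chartAt E p).source) (u v : E) :
    chartForm g p (extChartAt 𝓘(ℝ, E) p q) (tder E E (extChartAt 𝓘(ℝ, E) p) q u)
      (tder E E (extChartAt 𝓘(ℝ, E) p) q v) = metForm g q u v := by
  have h := tder_extChart_symm_comp hq
  have hu := DFunLike.congr_fun h u
  have hv := DFunLike.congr_fun h v
  have hl : (extChartAt 𝓘(ℝ, E) p).symm (extChartAt 𝓘(ℝ, E) p q) = q :=
    (extChartAt 𝓘(ℝ, E) p).left_inv (by simpa using hq)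
  simp only [ContinuousLinearMap.comp_apply, ContinuousLinearMap.id_apply] at hu hv
  rw [chartForm, pullForm_apply, hu, hv, hl]

theorem contDiffAt_chartForm_self :
    ContDiffAt ℝ ∞ (chartForm g p) (extChartAt 𝓘(ℝ, E) p p) := by
  have h := (contMDiffAt_bilin_section_iff g.inner p).1
    g.contMDiff.contMDiffAt
  rw [← contMDiffAt_iff_contDiffAt]
  have hm := mem_extChartAt_target (I := 𝓘(ℝ, E)) p
  have h2 := ContMDiffAt.comp_of_eq (x := extChartAt 𝓘(ℝ, E) p p) h
    (contMDiffAt_extChart_symm hm) (extChartAt_to_inv p)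
  refine h2.congr_of_eventuallyEq ?_
  filter_upwards [(isOpen_extChartAt_target p).mem_nhds hm] with x hx
  simp only [Function.comp_apply, (extChartAt 𝓘(ℝ, E) p).right_inv hx]
  rfl

/-- Near `x` the form is the pullback, along the transition map `ψ`, of the form in the chart
centred at the point `q` over `x`. At the centre of its own chart smoothness is that of the bundle
section. -/
theorem contDiffAt_chartForm {x : E} (hx : x ∈ (extChartAt 𝓘(ℝ, E) p).target) :
    ContDiffAt ℝ ∞ (chartForm g p) x := by
  set q := (extChartAt 𝓘(ℝ, E) p).symm x with hq
  have hsymm := contMDiffAt_extChart_symm hx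
  set ψ : E → E := fun y => extChartAt 𝓘(ℝ, E) q ((extChartAt 𝓘(ℝ, E) p).symm y) with hψ
  have hψs : ContDiffAt ℝ ∞ ψ x := by
    rw [← contMDiffAt_iff_contDiffAt]
    exact ContMDiffAt.comp_of_eq (contMDiffAt_extChart (mem_chart_source E q)) hsymm rfl
  have hd : ContDiffAt ℝ ∞ (fderiv ℝ ψ) x := hψs.fderiv_right (by simp)
  have hc := (contDiffAt_chartForm_self g (p := q)).comp x hψs
  refine (contDiff_pullForm.contDiffAt.comp x (hc.prodMk hd)).congr_of_eventuallyEq ?_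
  filter_upwards [(isOpen_extChartAt_target p).mem_nhds hx,
    hsymm.continuousAt.preimage_mem_nhds
      ((chartAt E q).open_source.mem_nhds (mem_chart_source E q))] with y hy hyq
  ext u v
  have hy' : (extChartAt 𝓘(ℝ, E) p).symm y ∈ (chartAt E q).source := hyq
  simp only [Function.comp_apply, pullForm_apply]
  rw [← tder_eq_fderiv, hψ, tder_comp ((contMDiffAt_extChart hy').mdifferentiableAt (by simp))
    ((contMDiffAt_extChart_symm hy).mdifferentiableAt (by simp)) rfl]
  exact (chartForm_extChart g hy' _ _).symm

/-- Replaces derivatives of single metric coefficients by the derivative of the form-valued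
function, the shape used in `first_variation` and `geodesic_ode_unique`. -/
theorem chartChristoffel_eq {x : E} (hx : x ∈ (extChartAt 𝓘(ℝ, E) p).target) (u w : E) :
    chartChristoffel g p x u w = fderiv ℝ (chartForm g p) x u u w
      - (1 / 2) * fderiv ℝ (chartForm g p) x w u u := by
  have hd : DifferentiableAt ℝ (chartForm g p) x :=
    (contDiffAt_chartForm g hx).differentiableAt (by simp)
  have key : ∀ a b c : E, fderiv ℝ (fun y => chartMetric g p y a b) x c
      = fderiv ℝ (chartForm g p) x c a b := by
    intro a b c
    have h := ((hd.hasFDerivAt.clm_apply (hasFDerivAt_const a x)).clm_apply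
      (hasFDerivAt_const b x)).fderiv
    have e : (fun y => chartMetric g p y a b) = fun y => chartForm g p y a b := rfl
    rw [e, h]; simp
  rw [chartChristoffel, key, key]

end MetricCharts

end TwoStepGO

end

noncomputable section

namespace TwoStepGO

/-! ### First variation of energy in coordinates -/

section FirstVariation

variable {E : Type*} [NormedAddCommGroup E] [NormedSpace ℝ E]

/-- The first variation of energy, in coordinates. If the speed of the curves `t ↦ c (s, t)` does
not depend on `s` and the product of the velocity and the variation field of the base curve is
constant, then the base curve satisfies the geodesic equation in the direction of the variation. -/
theorem first_variation {h : E → E →L[ℝ] E →L[ℝ] ℝ} {c : ℝ × ℝ → E} {t₀ : ℝ}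
    (hsymm : ∀ x u v, h x u v = h x v u)
    (hh : DifferentiableAt ℝ h (c (0, t₀))) (hc : ContDiffAt ℝ 2 c (0, t₀))
    (h₁ : ∀ᶠ s in 𝓝 (0 : ℝ), h (c (s, t₀)) (fderiv ℝ c (s, t₀) (0, 1)) (fderiv ℝ c (s, t₀) (0, 1))
      = h (c (0, t₀)) (fderiv ℝ c (0, t₀) (0, 1)) (fderiv ℝ c (0, t₀) (0, 1)))
    (h₂ : ∀ᶠ t in 𝓝 t₀, h (c (0, t)) (fderiv ℝ c (0, t) (0, 1)) (fderiv ℝ c (0, t) (1, 0))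
      = h (c (0, t₀)) (fderiv ℝ c (0, t₀) (0, 1)) (fderiv ℝ c (0, t₀) (1, 0))) :
    h (c (0, t₀)) (deriv (deriv (fun t => c (0, t))) t₀) (fderiv ℝ c (0, t₀) (1, 0))
      + (fderiv ℝ h (c (0, t₀)) (fderiv ℝ c (0, t₀) (0, 1)) (fderiv ℝ c (0, t₀) (0, 1))
          (fderiv ℝ c (0, t₀) (1, 0))
        - (1 / 2) * fderiv ℝ h (c (0, t₀)) (fderiv ℝ c (0, t₀) (1, 0))
          (fderiv ℝ c (0, t₀) (0, 1)) (fderiv ℝ c (0, t₀) (0, 1))) = 0 := by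
  have hc1 : DifferentiableAt ℝ c (0, t₀) := hc.differentiableAt (by simp)
  have hc2 : DifferentiableAt ℝ (fderiv ℝ c) (0, t₀) :=
    (hc.fderiv_right (m := 1) (by norm_num)).differentiableAt (by simp)
  have hs : HasDerivAt (fun s : ℝ => (s, t₀)) ((1 : ℝ), (0 : ℝ)) 0 :=
    (hasDerivAt_id 0).prodMk (hasDerivAt_const _ _)
  have ht : HasDerivAt (fun t : ℝ => ((0 : ℝ), t)) ((0 : ℝ), (1 : ℝ)) t₀ :=
    (hasDerivAt_const _ _).prodMk (hasDerivAt_id _)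
  set T := fderiv ℝ c (0, t₀) (0, 1) with hT
  set S := fderiv ℝ c (0, t₀) (1, 0) with hS
  set D2 := fderiv ℝ (fderiv ℝ c) (0, t₀) with hD2
  have hsy : D2 (1, 0) (0, 1) = D2 (0, 1) (1, 0) :=
    hc.isSymmSndFDerivAt (by simp) (1, 0) (0, 1)
  have hcs : HasDerivAt (fun s => c (s, t₀)) S 0 := hc1.hasFDerivAt.comp_hasDerivAt (0 : ℝ) hs
  have hct : HasDerivAt (fun t => c (0, t)) T t₀ := hc1.hasFDerivAt.comp_hasDerivAt t₀ ht
  have hds : HasDerivAt (fun s => fderiv ℝ c (s, t₀)) (D2 (1, 0)) 0 :=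
    hc2.hasFDerivAt.comp_hasDerivAt (0 : ℝ) hs
  have hdt : HasDerivAt (fun t => fderiv ℝ c (0, t)) (D2 (0, 1)) t₀ :=
    hc2.hasFDerivAt.comp_hasDerivAt t₀ ht
  have hsec : deriv (deriv (fun t => c (0, t))) t₀ = D2 (0, 1) (0, 1) := by
    have e : deriv (fun t => c (0, t)) =ᶠ[𝓝 t₀] fun t => fderiv ℝ c (0, t) (0, 1) := by
      have hev : ∀ᶠ p in 𝓝 ((0 : ℝ), t₀), DifferentiableAt ℝ c p :=
        (hc.eventually (by simp)).mono fun p hp => hp.differentiableAt (by simp)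
      filter_upwards [ht.continuousAt.eventually hev] with t hp
      exact (hp.hasFDerivAt.comp_hasDerivAt t
        ((hasDerivAt_const _ _).prodMk (hasDerivAt_id _))).deriv
    rw [e.deriv_eq]
    simpa using (hdt.clm_apply (hasDerivAt_const t₀ ((0 : ℝ), (1 : ℝ)))).deriv
  have k1 : HasDerivAt (fun s => h (c (s, t₀)) (fderiv ℝ c (s, t₀) (0, 1))
      (fderiv ℝ c (s, t₀) (0, 1)))
      (fderiv ℝ h (c (0, t₀)) S T T + h (c (0, t₀)) (D2 (1, 0) (0, 1)) T
        + h (c (0, t₀)) T (D2 (1, 0) (0, 1))) 0 := by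
    have a : HasDerivAt (fun s => h (c (s, t₀))) (fderiv ℝ h (c (0, t₀)) S) 0 :=
      HasFDerivAt.comp_hasDerivAt (l := h) (f := fun s => c (s, t₀)) (0 : ℝ) hh.hasFDerivAt hcs
    have b := hds.clm_apply (hasDerivAt_const (0 : ℝ) ((0 : ℝ), (1 : ℝ)))
    convert! (a.clm_apply b).clm_apply b using 1
    simp [hT]
  have k2 : HasDerivAt (fun t => h (c (0, t)) (fderiv ℝ c (0, t) (0, 1))
      (fderiv ℝ c (0, t) (1, 0)))
      (fderiv ℝ h (c (0, t₀)) T T S + h (c (0, t₀)) (D2 (0, 1) (0, 1)) S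
        + h (c (0, t₀)) T (D2 (0, 1) (1, 0))) t₀ := by
    have a : HasDerivAt (fun t => h (c (0, t))) (fderiv ℝ h (c (0, t₀)) T) t₀ :=
      HasFDerivAt.comp_hasDerivAt (l := h) (f := fun t => c (0, t)) t₀ hh.hasFDerivAt hct
    have b := hdt.clm_apply (hasDerivAt_const t₀ ((0 : ℝ), (1 : ℝ)))
    have d := hdt.clm_apply (hasDerivAt_const t₀ ((1 : ℝ), (0 : ℝ)))
    convert! (a.clm_apply b).clm_apply d using 1
    simp [hT, hS]
  -- With `T` and `S` the `t`- and `s`-velocities, the two constant functions give `D_S h(T,T) + 2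
  -- h(∂ₛ∂ₜc, T) = 0` and `D_T h(T,S) + h(c'', S) + h(T, ∂ₜ∂ₛc) = 0`. Subtracting half the first
  -- from the second cancels the mixed derivatives.
  have z1 := k1.unique ((hasDerivAt_const (0 : ℝ) _).congr_of_eventuallyEq h₁)
  have z2 := k2.unique ((hasDerivAt_const t₀ _).congr_of_eventuallyEq h₂)
  rw [hsymm _ (D2 (1, 0) (0, 1)) T, hsy] at z1
  rw [hsec]
  linarith

end FirstVariation

/-! ### Uniqueness of geodesics -/

section Uniqueness

variable {E : Type*} [NormedAddCommGroup E] [NormedSpace ℝ E] [FiniteDimensional ℝ E]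

theorem isInvertible_of_pos {B : E →L[ℝ] E →L[ℝ] ℝ} (hB : ∀ u, u ≠ 0 → 0 < B u u) :
    B.IsInvertible := by
  have hinj : Function.Injective (B : E →ₗ[ℝ] E →L[ℝ] ℝ) := by
    rw [injective_iff_map_eq_zero]
    intro u hu
    by_contra hne
    have h2 : B u = 0 := hu
    have h1 := hB u hne
    simp [h2] at h1
  have hfin : Module.finrank ℝ E = Module.finrank ℝ (E →L[ℝ] ℝ) := by
    rw [← (LinearMap.toContinuousLinearMap (𝕜 := ℝ) (E := E) (F' := ℝ)).finrank_eq]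
    exact (Subspace.dual_finrank_eq (K := ℝ) (V := E)).symm
  exact ⟨(LinearMap.linearEquivOfInjective (B : E →ₗ[ℝ] E →L[ℝ] ℝ) hinj
    hfin).toContinuousLinearEquiv, by ext; rfl⟩

/-- In finite dimension an operator is a tuple of its values on a basis, through a linear
equivalence. -/
theorem contDiffAt_of_apply {X W : Type*} [NormedAddCommGroup X] [NormedSpace ℝ X]
    [NormedAddCommGroup W] [NormedSpace ℝ W] {n : WithTop ℕ∞} {f : X → E →L[ℝ] W} {x : X}
    (hf : ∀ w, ContDiffAt ℝ n (fun y => f y w) x) : ContDiffAt ℝ n f x := by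
  let d := Module.finrank ℝ E
  have hd : d = Module.finrank ℝ (Fin d → ℝ) := (Module.finrank_fin_fun ℝ).symm
  let e₁ := ContinuousLinearEquiv.ofFinrankEq hd
  let e₂ := (e₁.arrowCongr (1 : W ≃L[ℝ] W)).trans (ContinuousLinearEquiv.piRing (Fin d))
  rw [← Function.id_comp f, ← e₂.symm_comp_self]
  exact e₂.symm.contDiff.contDiffAt.comp x (contDiffAt_pi.mpr fun i => hf _)

theorem contDiffAt_fderiv_apply {X W V : Type*} [NormedAddCommGroup X] [NormedSpace ℝ X]
    [NormedAddCommGroup W] [NormedSpace ℝ W] [NormedAddCommGroup V] [NormedSpace ℝ V]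
    {h : V → W} {a b : X → V} {x : X} (hh : ContDiffAt ℝ 2 h (a x))
    (ha : ContDiffAt ℝ 1 a x) (hb : ContDiffAt ℝ 1 b x) :
    ContDiffAt ℝ 1 (fun y => fderiv ℝ h (a y) (b y)) x :=
  (ContDiffAt.comp (g := fderiv ℝ h) x (hh.fderiv_right (by norm_num)) ha).clm_apply hb

/-- Local uniqueness for the geodesic equation in coordinates. -/
theorem geodesic_ode_unique {h : E → E →L[ℝ] E →L[ℝ] ℝ} {c d : ℝ → E} {t₀ : ℝ}
    (hh : ContDiffAt ℝ 2 h (c t₀)) (hpos : ∀ᶠ x in 𝓝 (c t₀), ∀ u, u ≠ 0 → 0 < h x u u)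
    (hc : ContDiffAt ℝ 2 c t₀) (hd : ContDiffAt ℝ 2 d t₀)
    (hcg : ∀ᶠ t in 𝓝 t₀, ∀ w, h (c t) (deriv (deriv c) t) w
      + (fderiv ℝ h (c t) (deriv c t) (deriv c t) w
        - (1 / 2) * fderiv ℝ h (c t) w (deriv c t) (deriv c t)) = 0)
    (hdg : ∀ᶠ t in 𝓝 t₀, ∀ w, h (d t) (deriv (deriv d) t) w
      + (fderiv ℝ h (d t) (deriv d t) (deriv d t) w
        - (1 / 2) * fderiv ℝ h (d t) w (deriv d t) (deriv d t)) = 0)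
    (h0 : c t₀ = d t₀) (h1 : deriv c t₀ = deriv d t₀) : c =ᶠ[𝓝 t₀] d := by
  have hinvev : ∀ᶠ x in 𝓝 (c t₀), (h x).IsInvertible := hpos.mono fun x => isInvertible_of_pos
  -- `Γ (x, u)` is the Christoffel term as a covector, and `v` is the geodesic equation solved for
  -- the second derivative, as a first-order system in position and velocity. It is `C¹`, hence
  -- locally Lipschitz.
  let Γ : E × E → E →L[ℝ] ℝ := fun p => fderiv ℝ h p.1 p.2 p.2
    - (1 / 2 : ℝ) • ((fderiv ℝ h p.1).flip p.2).flip p.2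
  let v : E × E → E × E := fun p => (p.2, -(h p.1).inverse (Γ p))
  have hv : ContDiffAt ℝ 1 v (c t₀, deriv c t₀) := by
    have hf : ContDiffAt ℝ 1 (fun p : E × E => p.1) (c t₀, deriv c t₀) := contDiffAt_fst
    have hs : ContDiffAt ℝ 1 (fun p : E × E => p.2) (c t₀, deriv c t₀) := contDiffAt_snd
    have hH : ContDiffAt ℝ 1 (fun p : E × E => (h p.1).inverse) (c t₀, deriv c t₀) :=
      ContDiffAt.comp (g := ContinuousLinearMap.inverse) (f := fun p : E × E => h p.1)
        (c t₀, deriv c t₀) hinvev.self_of_nhds.contDiffAt_map_inverse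
        (ContDiffAt.comp (g := h) (f := Prod.fst) (c t₀, deriv c t₀)
          (hh.of_le (by norm_num)) contDiffAt_fst)
    have hΓ : ContDiffAt ℝ 1 Γ (c t₀, deriv c t₀) := by
      refine contDiffAt_of_apply fun w => ?_
      have h1 := (((contDiffAt_fderiv_apply (a := Prod.fst) hh hf hs).clm_apply hs).clm_apply
        (contDiffAt_const (c := w)))
      have h2 := (((contDiffAt_fderiv_apply (a := Prod.fst) hh hf (contDiffAt_const (c := w))).clm_apply
        hs).clm_apply hs)
      exact h1.sub (contDiffAt_const.smul h2)
    exact hs.prodMk ((hH.clm_apply hΓ).neg)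
  obtain ⟨K, U, hU, hL⟩ := hv.exists_lipschitzOnWith
  have key : ∀ e : ℝ → E, ContDiffAt ℝ 2 e t₀ → e t₀ = c t₀ → deriv e t₀ = deriv c t₀ →
      (∀ᶠ t in 𝓝 t₀, ∀ w, h (e t) (deriv (deriv e) t) w
        + (fderiv ℝ h (e t) (deriv e t) (deriv e t) w
          - (1 / 2) * fderiv ℝ h (e t) w (deriv e t) (deriv e t)) = 0) →
      ∀ᶠ t in 𝓝 t₀, HasDerivAt (fun t => (e t, deriv e t)) (v (e t, deriv e t)) t ∧
        (e t, deriv e t) ∈ U := by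
    intro e he e0 e1 heg
    have hde : ContDiffAt ℝ 1 (deriv e) t₀ := by
      have := (he.fderiv_right (m := 1) (by norm_num)).clm_apply
        (contDiffAt_const (c := (1 : ℝ)))
      simpa using this
    have hcont : ContinuousAt (fun t => (e t, deriv e t)) t₀ :=
      he.continuousAt.prodMk hde.continuousAt
    have hU' : U ∈ 𝓝 (e t₀, deriv e t₀) := by rwa [e0, e1]
    have hinv' : ∀ᶠ x in 𝓝 (e t₀), (h x).IsInvertible := by rwa [e0]
    filter_upwards [heg, he.eventually (by simp), hde.eventually (by simp),
      hcont.preimage_mem_nhds hU', he.continuousAt.eventually hinv'] with t g1 g2 g3 g4 g5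
    refine ⟨?_, g4⟩
    have hsec : deriv (deriv e) t = -(h (e t)).inverse (Γ (e t, deriv e t)) := by
      have : h (e t) (deriv (deriv e) t) = -Γ (e t, deriv e t) := by
        ext w
        have := g1 w
        simp [Γ]
        linarith
      rw [← map_neg, ← this]
      exact (g5.inverse_apply_self _).symm
    simp only [v]
    rw [← hsec]
    exact (g2.differentiableAt (by simp)).hasDerivAt.prodMk
      (g3.differentiableAt (by simp)).hasDerivAt
  have hfin := ODE_solution_unique_of_eventually (v := fun _ => v) (s := fun _ => U) (K := K)
    (Filter.Eventually.of_forall fun _ => hL) (key c hc rfl rfl hcg)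
    (key d hd h0.symm h1.symm hdg) (by simp [h0, h1])
  exact hfin.mono fun t ht => congrArg Prod.fst ht

variable {M : Type*} [TopologicalSpace M] [ChartedSpace E M] [IsManifold 𝓘(ℝ, E) ∞ M]
  {g : SmoothMetric E M} {γ γ₁ γ₂ : ℝ → M} {J : Set ℝ} {t : ℝ} {p : M}

omit [FiniteDimensional ℝ E] in
theorem contDiffAt_extChart_curve (hγ : ContMDiffAt 𝓘(ℝ, ℝ) 𝓘(ℝ, E) ∞ γ t)
    (hp : γ t ∈ (chartAt E p).source) :
    ContDiffAt ℝ ∞ (fun s => extChartAt 𝓘(ℝ, E) p (γ s)) t := by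
  rw [← contMDiffAt_iff_contDiffAt]
  exact ContMDiffAt.comp_of_eq (contMDiffAt_extChart hp) hγ rfl

omit [FiniteDimensional ℝ E] in
theorem IsGeodesicOn.mono {J' : Set ℝ} (h : IsGeodesicOn g γ J) (hJ : J' ⊆ J) :
    IsGeodesicOn g γ J' :=
  ⟨h.1.mono hJ, fun t ht => h.2 t (hJ ht)⟩

omit [FiniteDimensional ℝ E] in
theorem IsGeodesicOn.contMDiffAt (h : IsGeodesicOn g γ J) (hJ : IsOpen J) (ht : t ∈ J) :
    ContMDiffAt 𝓘(ℝ, ℝ) 𝓘(ℝ, E) ∞ γ t :=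
  h.1.contMDiffAt (hJ.mem_nhds ht)

omit [FiniteDimensional ℝ E] in
theorem IsGeodesicOn.eventually_chart (h : IsGeodesicOn g γ J) (hJ : IsOpen J) (ht : t ∈ J)
    (hp : γ t ∈ (chartAt E p).source) :
    let c : ℝ → E := fun s => extChartAt 𝓘(ℝ, E) p (γ s)
    ∀ᶠ s in 𝓝 t, ∀ w, chartForm g p (c s) (deriv (deriv c) s) w
      + (fderiv ℝ (chartForm g p) (c s) (deriv c s) (deriv c s) w
        - (1 / 2) * fderiv ℝ (chartForm g p) (c s) w (deriv c s) (deriv c s)) = 0 := by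
  intro c
  filter_upwards [hJ.mem_nhds ht, (h.contMDiffAt hJ ht).continuousAt.preimage_mem_nhds
    ((chartAt E p).open_source.mem_nhds hp)] with s hs hsp w
  rw [← chartChristoffel_eq g ((extChartAt 𝓘(ℝ, E) p).map_source (by simpa using hsp))]
  exact h.2 s hs p hsp w

theorem IsGeodesicOn.eventuallyEq (h₁ : IsGeodesicOn g γ₁ J) (h₂ : IsGeodesicOn g γ₂ J)
    (hJ : IsOpen J) (ht : t ∈ J) (h0 : γ₁ t = γ₂ t)
    (hd : deriv (fun s => extChartAt 𝓘(ℝ, E) (γ₁ t) (γ₁ s)) t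
      = deriv (fun s => extChartAt 𝓘(ℝ, E) (γ₁ t) (γ₂ s)) t) : γ₁ =ᶠ[𝓝 t] γ₂ := by
  set p := γ₁ t with hp
  have hp₁ : γ₁ t ∈ (chartAt E p).source := mem_chart_source E p
  have hp₂ : γ₂ t ∈ (chartAt E p).source := h0 ▸ hp₁
  have hx : extChartAt 𝓘(ℝ, E) p (γ₁ t) ∈ (extChartAt 𝓘(ℝ, E) p).target :=
    (extChartAt 𝓘(ℝ, E) p).map_source (by simpa using hp₁)
  have key := geodesic_ode_unique (h := chartForm g p)
    (c := fun s => extChartAt 𝓘(ℝ, E) p (γ₁ s)) (d := fun s => extChartAt 𝓘(ℝ, E) p (γ₂ s))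
    ((contDiffAt_chartForm g hx).of_le (by norm_cast))
    (Filter.mem_of_superset ((isOpen_extChartAt_target p).mem_nhds hx)
      fun x hx u hu => chartForm_pos g hx hu)
    ((contDiffAt_extChart_curve (h₁.contMDiffAt hJ ht) hp₁).of_le (by norm_cast))
    ((contDiffAt_extChart_curve (h₂.contMDiffAt hJ ht) hp₂).of_le (by norm_cast))
    (h₁.eventually_chart hJ ht hp₁) (h₂.eventually_chart hJ ht hp₂)
    (congrArg (extChartAt 𝓘(ℝ, E) p) h0) hd
  filter_upwards [key, (h₁.contMDiffAt hJ ht).continuousAt.preimage_mem_nhds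
    ((chartAt E p).open_source.mem_nhds hp₁), (h₂.contMDiffAt hJ ht).continuousAt.preimage_mem_nhds
    ((chartAt E p).open_source.mem_nhds hp₂)] with s hs hs₁ hs₂
  exact (extChartAt 𝓘(ℝ, E) p).injOn (by simpa using hs₁) (by simpa using hs₂) hs

/-- Uniqueness of geodesics with given initial position and velocity. -/
theorem IsGeodesicOn.eqOn [T2Space M] (h₁ : IsGeodesicOn g γ₁ J) (h₂ : IsGeodesicOn g γ₂ J)
    (hJ : IsOpen J) (hJc : J.OrdConnected) (ht : t ∈ J) (h0 : γ₁ t = γ₂ t)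
    (hv : velocity E γ₁ t = velocity E γ₂ t) : Set.EqOn γ₁ γ₂ J := by
  have hsub : J ⊆ {s | γ₁ =ᶠ[𝓝 s] γ₂} := by
    -- The times near which the curves agree form an open set by definition. By connectedness of `J`
    -- it remains to find one such time and to see that this set is closed in `J`.
    refine hJc.isPreconnected.subset_of_closure_inter_subset isOpen_setOfPred_eventually_nhds
      ⟨t, ht, ?_⟩ ?_
    · refine h₁.eventuallyEq h₂ hJ ht h0 ?_
      rw [← velocity_eq_deriv, ← velocity_eq_deriv,
        velocity_comp ((contMDiffAt_extChart (mem_chart_source E (γ₁ t))).mdifferentiableAt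
          (by simp)) ((h₁.contMDiffAt hJ ht).mdifferentiableAt (by simp)) rfl,
        velocity_comp ((contMDiffAt_extChart (mem_chart_source E (γ₁ t))).mdifferentiableAt
          (by simp)) ((h₂.contMDiffAt hJ ht).mdifferentiableAt (by simp)) h0.symm, hv]
    · rintro s ⟨hs, hsJ⟩
      rw [mem_closure_iff_frequently] at hs
      have hc₁ := (h₁.contMDiffAt hJ hsJ)
      have hc₂ := (h₂.contMDiffAt hJ hsJ)
      have e0 : γ₁ s = γ₂ s := by
        by_contra hne
        obtain ⟨r, hr, hr'⟩ := (hs.and_eventually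
          (hc₁.continuousAt.ne_iff_eventually_ne hc₂.continuousAt |>.1 hne)).exists
        exact hr' hr.self_of_nhds
      refine h₁.eventuallyEq h₂ hJ hsJ e0 ?_
      have hd₁ := contDiffAt_extChart_curve hc₁ (mem_chart_source E (γ₁ s))
      have hd₂ := contDiffAt_extChart_curve (p := γ₁ s) hc₂ (e0 ▸ mem_chart_source E (γ₁ s))
      have hcont : ∀ {c : ℝ → E}, ContDiffAt ℝ ∞ c s → ContinuousAt (deriv c) s := by
        intro c hc
        have := (hc.fderiv_right (m := 1) (by norm_cast)).continuousAt.clm_apply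
          (continuousAt_const (y := (1 : ℝ)))
        simpa using this
      -- Distinct chart velocities at `s` would stay distinct nearby, yet `s` is a limit of times
      -- around which the curves coincide.
      by_contra hne
      obtain ⟨r, hr, hr'⟩ := (hs.and_eventually
        ((hcont hd₁).ne_iff_eventually_ne (hcont hd₂) |>.1 hne)).exists
      exact hr' (Filter.EventuallyEq.deriv_eq
        (hr.mono fun a ha => congrArg (extChartAt 𝓘(ℝ, E) (γ₁ s)) ha))
  exact fun s hs => (hsub hs).self_of_nhds

end Uniqueness

end TwoStepGO

end

/-! ### One-parameter subgroups and the exponential map -/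

noncomputable section

namespace TwoStepGO

/-- Bootstrapping: if `c` is `Cᵏ` then so is `c' = F ∘ c`, hence `c` is `Cᵏ⁺¹`. For each finite
order the argument runs on one fixed neighbourhood. -/
theorem contDiffAt_of_ode {E : Type*} [NormedAddCommGroup E] [NormedSpace ℝ E] {F : E → E}
    {c : ℝ → E} {t₀ : ℝ} (hF : ContDiffAt ℝ ∞ F (c t₀))
    (hc : ∀ᶠ t in 𝓝 t₀, HasDerivAt c (F (c t)) t) : ContDiffAt ℝ ∞ c t₀ := by
  rw [contDiffAt_infty]
  intro n
  have hFn : ∀ᶠ x in 𝓝 (c t₀), ContDiffAt ℝ n F x :=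
    (hF.of_le (by exact_mod_cast le_top)).eventually (by simp)
  obtain ⟨U, hU, hUo, ht⟩ := eventually_nhds_iff.1
    (hc.and (hc.self_of_nhds.continuousAt.eventually hFn))
  have key : ∀ k : ℕ, k ≤ n → ContDiffOn ℝ k c U := by
    intro k
    induction k with
    | zero =>
      intro _
      exact contDiffOn_zero.2 fun t ht => (hU t ht).1.continuousAt.continuousWithinAt
    | succ k ih =>
      intro hk
      have h1 : (((k + 1 : ℕ) : ℕ∞) : WithTop ℕ∞) = (k : WithTop ℕ∞) + 1 := by norm_cast
      have h2 : ContDiffOn ℝ k (deriv c) U := by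
        refine ContDiffOn.congr (f := fun t => F (c t)) (fun t ht => ?_)
          fun t ht => (hU t ht).1.deriv
        exact ((hU t ht).2.of_le (by exact_mod_cast (Nat.le_of_succ_le hk))).comp_contDiffWithinAt
          t (ih (Nat.le_of_succ_le hk) t ht)
      have h3 := (contDiffOn_succ_iff_deriv_of_isOpen (n := (k : WithTop ℕ∞)) hUo).2
        ⟨fun t ht => (hU t ht).1.differentiableAt.differentiableWithinAt, by simp, h2⟩
      exact_mod_cast h3
  exact (key n le_rfl).contDiffAt (hUo.mem_nhds ht)

section LieExp

variable {E : Type*} [NormedAddCommGroup E] [NormedSpace ℝ E]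
  {M : Type*} [TopologicalSpace M] [ChartedSpace E M]

theorem hasMFDerivAt_curve_iff {γ : ℝ → M} {t : ℝ} {v : TangentSpace 𝓘(ℝ, E) (γ t)} :
    HasMFDerivAt 𝓘(ℝ, ℝ) 𝓘(ℝ, E) γ t ((1 : ℝ →L[ℝ] ℝ).smulRight v) ↔
      MDifferentiableAt 𝓘(ℝ, ℝ) 𝓘(ℝ, E) γ t ∧ velocity E γ t = v := by
  constructor
  · intro h
    refine ⟨h.mdifferentiableAt, (DFunLike.congr_fun h.mfderiv (1 : ℝ)).trans ?_⟩
    exact one_smul ℝ v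
  · rintro ⟨h, hv⟩
    have h' := h.hasMFDerivAt
    have e : mfderiv 𝓘(ℝ, ℝ) 𝓘(ℝ, E) γ t = (1 : ℝ →L[ℝ] ℝ).smulRight v := by
      apply ContinuousLinearMap.ext_ring
      exact hv.trans (one_smul ℝ v).symm
    rwa [e] at h'

variable {G : Type*} [TopologicalSpace G] [ChartedSpace E G] [Group G] [LieGroup 𝓘(ℝ, E) ∞ G]

theorem mdifferentiableAt_mul_left (a x : G) :
    MDifferentiableAt 𝓘(ℝ, E) 𝓘(ℝ, E) (fun y : G => a * y) x :=
  (contMDiff_mul_left (I := 𝓘(ℝ, E)) (n := ∞)).mdifferentiableAt (by simp)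

theorem mdifferentiableAt_mul_right (a x : G) :
    MDifferentiableAt 𝓘(ℝ, E) 𝓘(ℝ, E) (fun y : G => y * a) x :=
  (contMDiff_mul_right (I := 𝓘(ℝ, E)) (n := ∞)).mdifferentiableAt (by simp)

theorem mulInvariantVectorField_mul (X : GroupLieAlgebra 𝓘(ℝ, E) G) (a x : G) :
    (mulInvariantVectorField X (a * x) : E)
      = tder E E (fun y : G => a * y) x (mulInvariantVectorField X x : E) := by
  have h := tder_comp (x := (1 : G)) (mdifferentiableAt_mul_left (E := E) a x)
    (mdifferentiableAt_mul_left (E := E) x 1) (mul_one x)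
  simp only [← mul_assoc] at h
  exact DFunLike.congr_fun h X

theorem hasMFDerivAt_mul_left_curve {X : GroupLieAlgebra 𝓘(ℝ, E) G} {γ : ℝ → G} {t : ℝ} (a : G)
    (h : HasMFDerivAt 𝓘(ℝ, ℝ) 𝓘(ℝ, E) γ t
      ((1 : ℝ →L[ℝ] ℝ).smulRight (mulInvariantVectorField X (γ t)))) :
    HasMFDerivAt 𝓘(ℝ, ℝ) 𝓘(ℝ, E) (fun s => a * γ s) t
      ((1 : ℝ →L[ℝ] ℝ).smulRight (mulInvariantVectorField X (a * γ t))) := by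
  rw [hasMFDerivAt_curve_iff] at h ⊢
  refine ⟨(mdifferentiableAt_mul_left a (γ t)).comp t h.1, ?_⟩
  rw [velocity_comp (mdifferentiableAt_mul_left a (γ t)) h.1 rfl, h.2]
  exact (mulInvariantVectorField_mul X a (γ t)).symm

theorem contMDiff_one_mulInvariantVectorField (X : GroupLieAlgebra 𝓘(ℝ, E) G) :
    ContMDiff 𝓘(ℝ, E) 𝓘(ℝ, E).tangent 1
      (fun a : G => (⟨a, mulInvariantVectorField X a⟩ : TangentBundle 𝓘(ℝ, E) G)) := by
  have : LieGroup 𝓘(ℝ, E) (minSmoothness ℝ 3) G :=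
    LieGroup.of_le (n := ∞) (by simp; norm_cast)
  exact (contMDiff_mulInvariantVectorField X).of_le (by simp)

variable [FiniteDimensional ℝ E] [T2Space G]

/-- A local integral curve at `1`, translated on the left, gives integral curves through all points
with the same time of existence `ε`; this forces completeness. -/
theorem exists_oneParameterSubgroup (X : GroupLieAlgebra 𝓘(ℝ, E) G) :
    ∃ φ : ℝ → G, φ 0 = 1 ∧ IsMIntegralCurve φ (mulInvariantVectorField X) := by
  have : IsManifold 𝓘(ℝ, E) 1 G := IsManifold.of_le (n := ∞) (by simp)
  have : CompleteSpace E := FiniteDimensional.complete ℝ E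
  obtain ⟨γ, hγ0, hγ⟩ := exists_isMIntegralCurveAt_of_contMDiffAt_boundaryless (t₀ := 0)
    (contMDiff_one_mulInvariantVectorField X (1 : G))
  obtain ⟨ε, hε, hγ⟩ := isMIntegralCurveAt_iff'.1 hγ
  rw [Real.ball_eq_Ioo, zero_sub, zero_add] at hγ
  refine exists_isMIntegralCurve_of_isMIntegralCurveOn (contMDiff_one_mulInvariantVectorField X) hε
    (fun a => ⟨fun t => a * γ t, by simp [hγ0], fun t ht => ?_⟩) 1
  exact (hasMFDerivAt_mul_left_curve a
    ((hγ t ht).hasMFDerivAt (isOpen_Ioo.mem_nhds ht))).hasMFDerivWithinAt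

theorem integralCurve_unique {X : GroupLieAlgebra 𝓘(ℝ, E) G} {φ ψ : ℝ → G}
    (hφ : IsMIntegralCurve φ (mulInvariantVectorField X))
    (hψ : IsMIntegralCurve ψ (mulInvariantVectorField X)) (h : φ 0 = ψ 0) : φ = ψ := by
  have : IsManifold 𝓘(ℝ, E) 1 G := IsManifold.of_le (n := ∞) (by simp)
  have : CompleteSpace E := FiniteDimensional.complete ℝ E
  exact isMIntegralCurve_Ioo_eq_of_contMDiff_boundaryless (t₀ := 0)
    (contMDiff_one_mulInvariantVectorField X) hφ hψ h

/-- Integral curves are unique, so the choice of `φ` made in `lieExp` is immaterial. -/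
theorem lieExp_eq {X : GroupLieAlgebra 𝓘(ℝ, E) G} {φ : ℝ → G} (h0 : φ 0 = 1)
    (hφ : IsMIntegralCurve φ (mulInvariantVectorField X)) : lieExp X = φ 1 := by
  have : Nonempty (ℝ → G) := ⟨fun _ => 1⟩
  have h := Classical.epsilon_spec (exists_oneParameterSubgroup X)
  exact congrFun (integralCurve_unique h.2 hφ (h.1.trans h0.symm)) 1

theorem lieExp_smul_eq {X : GroupLieAlgebra 𝓘(ℝ, E) G} {φ : ℝ → G} (h0 : φ 0 = 1)
    (hφ : IsMIntegralCurve φ (mulInvariantVectorField X)) (t : ℝ) : lieExp (t • X) = φ t := by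
  have h := hφ.comp_mul t
  rw [← mulInvariantVectorField_smul] at h
  simpa using lieExp_eq (φ := φ ∘ (· * t)) (by simp [h0]) h

theorem isMIntegralCurve_lieExp (X : GroupLieAlgebra 𝓘(ℝ, E) G) :
    IsMIntegralCurve (fun t : ℝ => lieExp (t • X)) (mulInvariantVectorField X) := by
  obtain ⟨φ, h0, hφ⟩ := exists_oneParameterSubgroup X
  rwa [show (fun t : ℝ => lieExp (t • X)) = φ from funext (lieExp_smul_eq h0 hφ)]

theorem lieExp_zero_smul (X : GroupLieAlgebra 𝓘(ℝ, E) G) : lieExp ((0 : ℝ) • X) = 1 := by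
  obtain ⟨φ, h0, hφ⟩ := exists_oneParameterSubgroup X
  rw [lieExp_smul_eq h0 hφ, h0]

/-- As functions of `t` both sides are integral curves of the same left-invariant field, with equal
values at `0`. -/
theorem lieExp_add_smul (X : GroupLieAlgebra 𝓘(ℝ, E) G) (s t : ℝ) :
    lieExp ((s + t) • X) = lieExp (s • X) * lieExp (t • X) := by
  have h1 := (isMIntegralCurve_lieExp X).comp_add s
  have h2 : IsMIntegralCurve (fun t : ℝ => lieExp (s • X) * lieExp (t • X))
      (mulInvariantVectorField X) := fun t =>
    hasMFDerivAt_mul_left_curve _ (isMIntegralCurve_lieExp X t)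
  have h0 : lieExp ((0 : ℝ) • X) = 1 := lieExp_zero_smul X
  have h3 := congrFun (integralCurve_unique h1 h2 (by simpa using h0)) t
  simpa [add_comm] using h3

theorem lieExp_neg_smul (X : GroupLieAlgebra 𝓘(ℝ, E) G) (t : ℝ) :
    lieExp ((-t) • X) = (lieExp (t • X))⁻¹ := by
  rw [eq_inv_iff_mul_eq_one, ← lieExp_add_smul, neg_add_cancel, lieExp_zero_smul]

/-- The integral-curve condition only provides a first derivative. In the chart at `1` the curve
solves an autonomous equation whose right-hand side comes from `A`, the derivative of left
translation read in that chart; `A` is smooth because multiplication is, and `contDiffAt_of_ode`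
applies. -/
theorem contMDiffAt_lieExp_smul_zero (X : GroupLieAlgebra 𝓘(ℝ, E) G) :
    ContMDiffAt 𝓘(ℝ, ℝ) 𝓘(ℝ, E) ∞ (fun t : ℝ => lieExp (t • X)) 0 := by
  set γ : ℝ → G := fun t => lieExp (t • X) with hγ
  have hγ' := fun t => hasMFDerivAt_curve_iff.1 (isMIntegralCurve_lieExp X t)
  have h0 : γ 0 = 1 := lieExp_zero_smul X
  let A : G → E →L[ℝ] E := fun a => (tder E E (extChartAt 𝓘(ℝ, E) (1 : G)) a).comp
    (tder E E (fun y : G => a * y) 1)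
  have hA : ContMDiffAt 𝓘(ℝ, E) 𝓘(ℝ, E →L[ℝ] E) ∞ A 1 := by
    have h := contMDiffAt_tder_param (f := fun a y : G => a * y) (g := fun _ : G => (1 : G))
      (q₀ := (1 : G)) (contMDiff_mul 𝓘(ℝ, E) ∞).contMDiffAt contMDiffAt_const
    simpa only [mul_one, tder_extChart_symm_self, ContinuousLinearMap.comp_id] using h
  have hm := mem_extChartAt_target (I := 𝓘(ℝ, E)) (1 : G)
  have hF : ContDiffAt ℝ ∞ (fun x => A ((extChartAt 𝓘(ℝ, E) (1 : G)).symm x) X)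
      (extChartAt 𝓘(ℝ, E) (1 : G) 1) := by
    have h := (ContMDiffAt.comp_of_eq (x := extChartAt 𝓘(ℝ, E) (1 : G) 1) hA
      (contMDiffAt_extChart_symm hm) (extChartAt_to_inv (1 : G))).contDiffAt
    exact h.clm_apply contDiffAt_const
  have hev : ∀ᶠ t in 𝓝 (0 : ℝ), γ t ∈ (chartAt E (1 : G)).source :=
    (hγ' 0).1.continuousAt.preimage_mem_nhds ((chartAt E (1 : G)).open_source.mem_nhds
      (by rw [zero_smul, ← zero_smul ℝ X, lieExp_zero_smul]; exact mem_chart_source E (1 : G)))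
  have hl : ∀ {t}, γ t ∈ (chartAt E (1 : G)).source →
      (extChartAt 𝓘(ℝ, E) (1 : G)).symm (extChartAt 𝓘(ℝ, E) (1 : G) (γ t)) = γ t := fun ht =>
    (extChartAt 𝓘(ℝ, E) (1 : G)).left_inv (by simpa using ht)
  have hc : ContDiffAt ℝ ∞ (fun t => extChartAt 𝓘(ℝ, E) (1 : G) (γ t)) 0 := by
    refine contDiffAt_of_ode (F := fun x => A ((extChartAt 𝓘(ℝ, E) (1 : G)).symm x) X)
      (by rwa [h0]) ?_
    filter_upwards [hev] with t ht
    have hd : MDifferentiableAt 𝓘(ℝ, E) 𝓘(ℝ, E) (extChartAt 𝓘(ℝ, E) (1 : G)) (γ t) :=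
      (contMDiffAt_extChart ht).mdifferentiableAt (by simp)
    have hv := velocity_comp hd (hγ' t).1 rfl
    rw [velocity_eq_deriv, (hγ' t).2] at hv
    have hdd : DifferentiableAt ℝ (fun t => extChartAt 𝓘(ℝ, E) (1 : G) (γ t)) t :=
      (hd.comp t (hγ' t).1).differentiableAt
    rw [hl ht]
    exact hv ▸ hdd.hasDerivAt
  refine (ContMDiffAt.comp_of_eq (contMDiffAt_extChart_symm hm) hc.contMDiffAt
    (by rw [h0])).congr_of_eventuallyEq ?_
  filter_upwards [hev] with t ht
  exact (hl ht).symm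

/-- Smoothness at `0` is carried to any `t` by `exp(sX) = exp(tX) exp((s-t)X)`. -/
theorem contMDiff_lieExp_smul (X : GroupLieAlgebra 𝓘(ℝ, E) G) :
    ContMDiff 𝓘(ℝ, ℝ) 𝓘(ℝ, E) ∞ (fun t : ℝ => lieExp (t • X)) := by
  intro t
  have h1 : ContMDiffAt 𝓘(ℝ, ℝ) 𝓘(ℝ, E) ∞ (fun s : ℝ => lieExp ((s - t) • X)) t :=
    ContMDiffAt.comp_of_eq (contMDiffAt_lieExp_smul_zero X)
      (contDiffAt_id.sub contDiffAt_const).contMDiffAt (sub_self t)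
  have h2 := (contMDiffAt_const (c := lieExp (t • X))).mul h1
  refine h2.congr_of_eventuallyEq (Filter.Eventually.of_forall fun s => ?_)
  change lieExp (s • X) = lieExp (t • X) * lieExp ((s - t) • X)
  rw [← lieExp_add_smul, add_sub_cancel]

theorem velocity_lieExp_smul (X : GroupLieAlgebra 𝓘(ℝ, E) G) (t : ℝ) :
    velocity E (fun t : ℝ => lieExp (t • X)) t
      = tder E E (fun y : G => lieExp (t • X) * y) 1 X :=
  (hasMFDerivAt_curve_iff.1 (isMIntegralCurve_lieExp X t)).2

theorem velocity_lieExp_zero (X : GroupLieAlgebra 𝓘(ℝ, E) G) :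
    velocity E (fun t : ℝ => lieExp (t • X)) 0 = X := by
  rw [velocity_lieExp_smul, lieExp_zero_smul]
  simp only [one_mul]
  rw [tder_id]
  rfl

end LieExp

end TwoStepGO

end

noncomputable section

namespace TwoStepGO

/-! ### Orthogonal projections for a positive definite form -/

section OrthProj

variable {E : Type*} [NormedAddCommGroup E] [NormedSpace ℝ E] [FiniteDimensional ℝ E]

/-- The orthogonal projection to a subspace, with respect to a positive definite bilinear form. -/
def orthProj (B : E →L[ℝ] E →L[ℝ] ℝ) (V : Submodule ℝ E) : E →L[ℝ] E :=
  V.subtypeL.comp ((pullForm B V.subtypeL).inverse.comp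
    (((ContinuousLinearMap.compL ℝ V E ℝ).flip V.subtypeL).comp B))

variable {B : E →L[ℝ] E →L[ℝ] ℝ} {V : Submodule ℝ E}

omit [FiniteDimensional ℝ E] in
theorem orthProj_mem (X : E) : orthProj B V X ∈ V := Submodule.coe_mem _

theorem orthProj_spec (hB : ∀ u, u ≠ 0 → 0 < B u u) (X : E) {Y : E} (hY : Y ∈ V) :
    B (orthProj B V X) Y = B X Y := by
  have hV : (pullForm B V.subtypeL).IsInvertible :=
    isInvertible_of_pos fun u hu => hB _ (by simpa using hu)
  exact DFunLike.congr_fun (hV.self_apply_inverse ((B X).comp V.subtypeL)) (⟨Y, hY⟩ : V)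

omit [FiniteDimensional ℝ E] in
theorem eq_of_forall_mem (hB : ∀ u, u ≠ 0 → 0 < B u u) {Z W : E} (hZ : Z ∈ V) (hW : W ∈ V)
    (h : ∀ Y ∈ V, B Z Y = B W Y) : Z = W := by
  by_contra hne
  have h1 := hB (Z - W) (sub_ne_zero.2 hne)
  have h2 : B (Z - W) (Z - W) = B Z (Z - W) - B W (Z - W) := by
    rw [map_sub B]; rfl
  rw [h2, h _ (V.sub_mem hZ hW), sub_self] at h1
  exact lt_irrefl _ h1

theorem orthProj_eq (hB : ∀ u, u ≠ 0 → 0 < B u u) {X Z : E} (hZ : Z ∈ V)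
    (h : ∀ Y ∈ V, B Z Y = B X Y) : orthProj B V X = Z :=
  eq_of_forall_mem hB (orthProj_mem X) hZ fun Y hY => (orthProj_spec hB X hY).trans (h Y hY).symm

theorem orthProj_of_mem (hB : ∀ u, u ≠ 0 → 0 < B u u) {X : E} (hX : X ∈ V) :
    orthProj B V X = X :=
  orthProj_eq hB hX fun _ _ => rfl

theorem orthProj_of_orth (hB : ∀ u, u ≠ 0 → 0 < B u u) {X : E} (hX : ∀ Y ∈ V, B X Y = 0) :
    orthProj B V X = 0 :=
  orthProj_eq hB V.zero_mem fun Y hY => by simp [hX Y hY]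

/-- `A` is isometric and maps `V` onto itself, the right inverse `A'` also preserving `V`; so every
test vector in `V` may be written as `A` of a vector in `V`. -/
theorem orthProj_comm (hB : ∀ u, u ≠ 0 → 0 < B u u) {A A' : E →L[ℝ] E}
    (hA : ∀ X Y, B (A X) (A Y) = B X Y) (hAV : ∀ X ∈ V, A X ∈ V) (hAV' : ∀ X ∈ V, A' X ∈ V)
    (hAA' : ∀ X, A (A' X) = X) (X : E) : orthProj B V (A X) = A (orthProj B V X) := by
  refine orthProj_eq hB (hAV _ (orthProj_mem X)) fun Y hY => ?_
  rw [← hAA' Y, hA, hA, orthProj_spec hB X (hAV' Y hY)]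

end OrthProj

/-! ### The adjoint representation and `Ad`-invariance -/

section Adjoint

variable (E : Type*) [NormedAddCommGroup E] [NormedSpace ℝ E]
  {G : Type*} [TopologicalSpace G] [ChartedSpace E G] [Group G]

/-- The adjoint representation of a Lie group. -/
def Ad (a : G) : E →L[ℝ] E := tder E E (fun y : G => a * y * a⁻¹) 1

theorem Ad_one : Ad E (1 : G) = ContinuousLinearMap.id ℝ E := by
  rw [Ad, ← tder_id (1 : G)]
  simp

variable [LieGroup 𝓘(ℝ, E) ∞ G]

theorem contMDiff_conj (a : G) : ContMDiff 𝓘(ℝ, E) 𝓘(ℝ, E) ∞ (fun y : G => a * y * a⁻¹) :=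
  (contMDiff_const.mul contMDiff_id).mul contMDiff_const

theorem mdifferentiableAt_conj (a x : G) :
    MDifferentiableAt 𝓘(ℝ, E) 𝓘(ℝ, E) (fun y : G => a * y * a⁻¹) x :=
  (contMDiff_conj E a).mdifferentiableAt (by simp)

theorem Ad_mul (a b : G) : Ad E (a * b) = (Ad E a).comp (Ad E b) := by
  rw [Ad, Ad, Ad, ← tder_comp (mdifferentiableAt_conj E a 1) (mdifferentiableAt_conj E b 1)
    (by simp)]
  simp only [mul_inv_rev, mul_assoc]

theorem Ad_mul_apply (a b : G) (X : E) : Ad E (a * b) X = Ad E a (Ad E b X) := by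
  rw [Ad_mul]; rfl

theorem Ad_apply_inv (a : G) (X : E) : Ad E a (Ad E a⁻¹ X) = X := by
  rw [← Ad_mul_apply, mul_inv_cancel, Ad_one]; rfl

theorem Ad_inv_apply (a : G) (X : E) : Ad E a⁻¹ (Ad E a X) = X := by
  rw [← Ad_mul_apply, inv_mul_cancel, Ad_one]; rfl

variable {E}

theorem IsBiInvariant.metForm_mul_left {b : SmoothMetric E G} (hb : IsBiInvariant b) (a x : G)
    (u v : E) : metForm b (a * x) (tder E E (fun y : G => a * y) x u)
      (tder E E (fun y : G => a * y) x v) = metForm b x u v := hb.1 a x u v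

theorem IsBiInvariant.metForm_mul_right {b : SmoothMetric E G} (hb : IsBiInvariant b) (a x : G)
    (u v : E) : metForm b (x * a) (tder E E (fun y : G => y * a) x u)
      (tder E E (fun y : G => y * a) x v) = metForm b x u v := hb.2 a x u v

/-- Conjugation is a left translation followed by a right translation, both isometries. -/
theorem IsBiInvariant.metForm_Ad {b : SmoothMetric E G} (hb : IsBiInvariant b) (a : G) (X Y : E) :
    metForm b 1 (Ad E a X) (Ad E a Y) = metForm b 1 X Y := by
  have h : Ad E a = (tder E E (fun y : G => y * a⁻¹) (a * 1)).comp
      (tder E E (fun y : G => a * y) 1) :=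
    tder_comp (mdifferentiableAt_mul_right _ _) (mdifferentiableAt_mul_left _ _) rfl
  have h1 := hb.metForm_mul_right a⁻¹ (a * 1) (tder E E (fun y : G => a * y) 1 X)
    (tder E E (fun y : G => a * y) 1 Y)
  rw [hb.metForm_mul_left] at h1
  rw [h, ← h1, mul_one, mul_inv_cancel]
  rfl

theorem IsBiInvariant.metForm_Ad_left {b : SmoothMetric E G} (hb : IsBiInvariant b) (a : G)
    (X Y : E) : metForm b 1 (Ad E a X) Y = metForm b 1 X (Ad E a⁻¹ Y) := by
  rw [← hb.metForm_Ad a X, Ad_apply_inv]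

theorem mem_lieAlgebraOf {K : Subgroup G} {X : E} :
    X ∈ (lieAlgebraOf K : Submodule ℝ E) ↔ ∃ c : ℝ → G, ContMDiff 𝓘(ℝ, ℝ) 𝓘(ℝ, E) ∞ c ∧
      (∀ t, c t ∈ K) ∧ c 0 = 1 ∧ velocity E c 0 = X := Iff.rfl

theorem Ad_mem_lieAlgebraOf {H : Subgroup G} {a : G} (ha : a ∈ H) {X : E}
    (hX : X ∈ (lieAlgebraOf H : Submodule ℝ E)) :
    Ad E a X ∈ (lieAlgebraOf H : Submodule ℝ E) := by
  obtain ⟨c, hc, hcH, hc0, rfl⟩ := mem_lieAlgebraOf.1 hX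
  refine mem_lieAlgebraOf.2 ⟨fun t => a * c t * a⁻¹, (contMDiff_conj E a).comp hc,
    fun t => H.mul_mem (H.mul_mem ha (hcH t)) (H.inv_mem ha), by simp [hc0], ?_⟩
  exact velocity_comp (mdifferentiableAt_conj E a 1) (hc.mdifferentiableAt (by simp)) hc0

/-- Conjugations fix `1`, so both charts involved are the one at `1` and their derivatives there are
the identity. -/
theorem contMDiffAt_Ad_one : ContMDiffAt 𝓘(ℝ, E) 𝓘(ℝ, E →L[ℝ] E) ∞ (Ad E : G → E →L[ℝ] E) 1 := by
  have hm : ContMDiff (𝓘(ℝ, E).prod 𝓘(ℝ, E)) 𝓘(ℝ, E) ∞ (fun p : G × G => p.1 * p.2 * p.1⁻¹) :=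
    (contMDiff_fst.mul contMDiff_snd).mul contMDiff_fst.inv
  have h := contMDiffAt_tder_param (f := fun a y : G => a * y * a⁻¹) (g := fun _ : G => (1 : G))
    (q₀ := (1 : G)) hm.contMDiffAt contMDiffAt_const
  simp only [mul_one, inv_one, mul_inv_cancel, tder_extChart_self, tder_extChart_symm_self,
    ContinuousLinearMap.comp_id, ContinuousLinearMap.id_comp] at h
  exact h

variable (E G) in
/-- The differential of the adjoint representation at the identity. -/
def adDeriv : E →L[ℝ] E →L[ℝ] E := tder E (E →L[ℝ] E) (Ad E : G → E →L[ℝ] E) 1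

theorem hasDerivAt_Ad {c : ℝ → G} {t : ℝ} (hc : MDifferentiableAt 𝓘(ℝ, ℝ) 𝓘(ℝ, E) c t)
    (hc0 : c t = 1) :
    HasDerivAt (fun s => Ad E (c s)) (adDeriv E G (velocity E c t)) t := by
  have hA : MDifferentiableAt 𝓘(ℝ, E) 𝓘(ℝ, E →L[ℝ] E) (Ad E : G → E →L[ℝ] E) 1 :=
    contMDiffAt_Ad_one.mdifferentiableAt (by simp)
  have h := velocity_comp hA hc hc0
  rw [velocity_eq_deriv] at h
  have hd : DifferentiableAt ℝ (fun s => Ad E (c s)) t :=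
    by
    rw [← hc0] at hA
    exact (MDifferentiableAt.comp (g := Ad E) t hA hc).differentiableAt
  rw [adDeriv, ← h]
  exact hd.hasDerivAt

variable [FiniteDimensional ℝ E] [T2Space G]

theorem mdifferentiableAt_lieExp_smul (X : GroupLieAlgebra 𝓘(ℝ, E) G) (t : ℝ) :
    MDifferentiableAt 𝓘(ℝ, ℝ) 𝓘(ℝ, E) (fun t : ℝ => lieExp (t • X)) t :=
  (contMDiff_lieExp_smul X).mdifferentiableAt (by simp)

theorem hasDerivAt_Ad_lieExp (C : GroupLieAlgebra 𝓘(ℝ, E) G) (t : ℝ) :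
    HasDerivAt (fun s : ℝ => Ad E (lieExp (s • C)))
      ((adDeriv E G C).comp (Ad E (lieExp (t • C)))) t := by
  have h0 : HasDerivAt (fun s : ℝ => Ad E (lieExp (s • C))) (adDeriv E G C) (t - t) := by
    rw [sub_self]
    have h := hasDerivAt_Ad (mdifferentiableAt_lieExp_smul C 0) (lieExp_zero_smul C)
    rwa [velocity_lieExp_zero] at h
  have h1 := (h0.comp_sub_const t t).clm_comp (hasDerivAt_const t (Ad E (lieExp (t • C))))
  simp only [← Ad_mul, ← lieExp_add_smul, sub_add_cancel] at h1
  simpa using h1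

theorem Ad_lieExp_self (X : GroupLieAlgebra 𝓘(ℝ, E) G) (t : ℝ) :
    Ad E (lieExp (t • X)) (X : E) = X := by
  have h := velocity_comp (mdifferentiableAt_conj E (lieExp (t • X)) 1)
    (mdifferentiableAt_lieExp_smul X 0) (lieExp_zero_smul X)
  rw [velocity_lieExp_zero] at h
  refine h.symm.trans ?_
  have e : (fun s : ℝ => lieExp (t • X) * lieExp (s • X) * (lieExp (t • X))⁻¹)
      = fun s : ℝ => lieExp (s • X) := by
    funext s
    rw [← lieExp_neg_smul, ← lieExp_add_smul, ← lieExp_add_smul]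
    congr 2
    ring
  rw [e, velocity_lieExp_zero]

/-- Differentiate the constant function `B(Ad(exp sC)W, Ad(exp sC)W)` at `s = 0`. -/
theorem adDeriv_skew {b : SmoothMetric E G} (hb : IsBiInvariant b)
    (C : GroupLieAlgebra 𝓘(ℝ, E) G) (W : E) : metForm b 1 (adDeriv E G C W) W = 0 := by
  have h0 := hasDerivAt_Ad (mdifferentiableAt_lieExp_smul C 0) (lieExp_zero_smul C)
  rw [velocity_lieExp_zero] at h0
  have h1 := h0.clm_apply (hasDerivAt_const (0 : ℝ) W)
  have h2 := ((hasDerivAt_const (0 : ℝ) (metForm b 1)).clm_apply h1).clm_apply h1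
  simp only [hb.metForm_Ad, lieExp_zero_smul, Ad_one] at h2
  have h3 := h2.unique (hasDerivAt_const _ _)
  simp [metForm_symm b 1 W] at h3
  linarith

/-- The subgroup generated by an element of the Lie algebra of `H` preserves this Lie algebra. -/
theorem Ad_lieExp_mem {b : SmoothMetric E G} (hb : IsBiInvariant b) {H : Subgroup G}
    {C : GroupLieAlgebra 𝓘(ℝ, E) G} (hC : C ∈ lieAlgebraOf H) {Y : E}
    (hY : Y ∈ (lieAlgebraOf H : Submodule ℝ E)) (t : ℝ) :
    Ad E (lieExp (t • C)) Y ∈ (lieAlgebraOf H : Submodule ℝ E) := by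
  have hB : ∀ u : E, u ≠ 0 → 0 < metForm b 1 u u := fun u => metForm_pos b 1
  set V : Submodule ℝ E := lieAlgebraOf H with hV
  set B := metForm b 1 with hBdef
  -- The projection to the orthogonal complement of `V = 𝔥`; the aim is that `p` kills `Ad(exp tC)Y`
  -- for all `t`.
  set p : E →L[ℝ] E := ContinuousLinearMap.id ℝ E - orthProj B V with hp
  have hpV : ∀ Z ∈ V, p Z = 0 := fun Z hZ => by simp [hp, orthProj_of_mem hB hZ]
  have hp0 : ∀ Z, p Z = 0 → Z ∈ V := fun Z hZ => by
    have : Z = orthProj B V Z := by simpa [hp, sub_eq_zero] using hZ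
    rw [this]; exact orthProj_mem Z
  have hsub : ∀ Z, Z - p Z ∈ V := fun Z => by simpa [hp] using orthProj_mem Z
  have hpo : ∀ Z, ∀ W ∈ V, B W (p Z) = 0 := fun Z W hW => by
    rw [hBdef, metForm_symm, ← hBdef]
    simp [hp, orthProj_spec hB Z hW]
  -- `ad C` preserves `𝔥`: differentiate `Ad(c s)Z ∈ 𝔥` along a curve `c` in `H` with velocity `C`.
  -- Only this curve is needed, not that `exp(tC)` lies in `H`.
  have had : ∀ Z ∈ V, p (adDeriv E G C Z) = 0 := by
    intro Z hZ
    obtain ⟨c, hc, hcH, hc0, hcC⟩ := (mem_lieAlgebraOf (E := E)).1 hC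
    have h1 := (hasDerivAt_Ad (hc.mdifferentiableAt (by simp)) hc0).clm_apply
      (hasDerivAt_const (0 : ℝ) Z)
    have h2 := (hasDerivAt_const (0 : ℝ) p).clm_apply h1
    simp only [hpV _ (Ad_mem_lieAlgebraOf (hcH _) hZ)] at h2
    have h3 := h2.unique (hasDerivAt_const _ _)
    rw [hcC] at h3
    simpa using h3
  let f : ℝ → E := fun s => p (Ad E (lieExp (s • C)) Y)
  have hf : ∀ s, HasDerivAt f (p (adDeriv E G C (f s))) s := by
    intro s
    have h1 := (hasDerivAt_Ad_lieExp C s).clm_apply (hasDerivAt_const s Y)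
    have h2 := (hasDerivAt_const s p).clm_apply h1
    convert! h2 using 1
    have h3 := had _ (hsub (Ad E (lieExp (s • C)) Y))
    rw [map_sub, map_sub, sub_eq_zero] at h3
    simpa [f] using h3.symm
  -- Since `f s` is orthogonal to `V`, `B(p(ad C f), f) = B(ad C f, f)`, which vanishes by skewness.
  -- So `f` has constant norm, and it starts at `0`.
  have hE : ∀ s, HasDerivAt (fun s => B (f s) (f s)) 0 s := by
    intro s
    have h1 := ((hasDerivAt_const s B).clm_apply (hf s)).clm_apply (hf s)
    convert! h1 using 1
    have h2 : B (p (adDeriv E G C (f s))) (f s) = 0 := by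
      have h3 := hpo (Ad E (lieExp (s • C)) Y) _ (hsub (adDeriv E G C (f s)))
      have h4 : B (adDeriv E G C (f s)) (f s) = 0 := adDeriv_skew hb C (f s)
      change B _ (f s) = 0 at h3
      rw [map_sub, _root_.sub_apply, h4] at h3
      linarith
    have h5 : B (f s) (p (adDeriv E G C (f s))) = 0 := by
      rw [hBdef, metForm_symm]; exact h2
    simp [h2, h5]
  have hconst := is_const_of_deriv_eq_zero (fun s => (hE s).differentiableAt)
    (fun s => (hE s).deriv) t 0
  have hf0 : f 0 = 0 := by
    simp only [f, lieExp_zero_smul, Ad_one]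
    exact hpV Y hY
  have hft : f t = 0 := by
    by_contra hne
    have h1 : 0 < B (f t) (f t) := hB _ hne
    have h2 : B (f t) (f t) = B (f 0) (f 0) := hconst
    rw [h2, hf0] at h1
    simp at h1
  exact hp0 _ hft

/-- An orthogonal map whose inverse preserves `𝔥` preserves `𝔥^⊥`. This keeps the `X₁` part of the
logarithmic derivative inside `𝔪₁`. -/
theorem Ad_lieExp_mem_orthCompl {b : SmoothMetric E G} (hb : IsBiInvariant b) {H : Subgroup G}
    {C : GroupLieAlgebra 𝓘(ℝ, E) G} (hC : C ∈ lieAlgebraOf H) {Y : E}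
    (hY : Y ∈ (mOne b H : Submodule ℝ E)) (t : ℝ) :
    Ad E (lieExp (t • C)) Y ∈ (mOne b H : Submodule ℝ E) := by
  intro Z hZ
  refine (hb.metForm_Ad_left _ Y Z).trans ?_
  rw [← lieExp_neg_smul]
  exact hY _ (Ad_lieExp_mem hb hC hZ _)

end Adjoint

end TwoStepGO

end

noncomputable section

namespace TwoStepGO

/-! ### Local sections and fibres of submersions -/

section Submersion

variable {E : Type*} [NormedAddCommGroup E] [NormedSpace ℝ E]
  {F : Type*} [NormedAddCommGroup F] [NormedSpace ℝ F]
  {M : Type*} [TopologicalSpace M] [ChartedSpace E M] [IsManifold 𝓘(ℝ, E) ∞ M]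
  {N : Type*} [TopologicalSpace N] [ChartedSpace F N] [IsManifold 𝓘(ℝ, F) ∞ N]
  {f : M → N}

omit [IsManifold 𝓘(ℝ, E) ∞ M] [IsManifold 𝓘(ℝ, F) ∞ N] in
/-- The normal form of a submersion. -/
theorem exists_submersion_normal_form (hf : Manifold.IsSubmersion 𝓘(ℝ, E) 𝓘(ℝ, F) ∞ f) (x : M) :
    ∃ (φ : OpenPartialHomeomorph M E) (ψ : OpenPartialHomeomorph N F) (L : E →L[ℝ] F)
      (R : F →L[ℝ] E), φ ∈ IsManifold.maximalAtlas 𝓘(ℝ, E) ∞ M ∧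
      ψ ∈ IsManifold.maximalAtlas 𝓘(ℝ, F) ∞ N ∧ x ∈ φ.source ∧
      (∀ y ∈ φ.source, f y ∈ ψ.source) ∧ (∀ z ∈ φ.target, ψ (f (φ.symm z)) = L z) ∧
      ∀ w, L (R w) = w := by
  have h := hf.isSubmersionOfComplement_complement x
  refine ⟨h.domChart, h.codChart,
    (ContinuousLinearMap.fst ℝ F hf.complement).comp (h.equiv : E →L[ℝ] F × hf.complement),
    (h.equiv.symm : F × hf.complement →L[ℝ] E).comp (ContinuousLinearMap.inl ℝ F hf.complement),
    h.domChart_mem_maximalAtlas, h.codChart_mem_maximalAtlas, h.mem_domChart_source,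
    fun y hy => h.mapsto_domChart_source_codChart_source hy, fun z hz => ?_, fun w => by simp⟩
  have hz' : z ∈ (h.domChart.extend 𝓘(ℝ, E)).target := by simpa using hz
  have := h.writtenInCharts hz'
  simpa using this

omit [IsManifold 𝓘(ℝ, E) ∞ M] [IsManifold 𝓘(ℝ, F) ∞ N] in
/-- A submersion has smooth local sections. -/
theorem exists_local_section (hf : Manifold.IsSubmersion 𝓘(ℝ, E) 𝓘(ℝ, F) ∞ f) (x : M) :
    ∃ σ : N → M, ContMDiffAt 𝓘(ℝ, F) 𝓘(ℝ, E) ∞ σ (f x) ∧ σ (f x) = x ∧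
      ∀ᶠ y in 𝓝 (f x), f (σ y) = y := by
  obtain ⟨φ, ψ, L, R, hφ, hψ, hx, hmaps, hL, hLR⟩ := exists_submersion_normal_form hf x
  have hLx : ψ (f x) = L (φ x) := by rw [← hL _ (φ.map_source hx), φ.left_inv hx]
  -- Lift the displacement `ψ y - ψ (f x)` by the right inverse `R`; since `ψ (f x) = L (φ x)`,
  -- applying `L` returns `ψ y`.
  set τ : N → E := fun y => φ x + R (ψ y - ψ (f x)) with hτ
  have hτx : τ (f x) = φ x := by simp [hτ]
  have hψs : ContMDiffAt 𝓘(ℝ, F) 𝓘(ℝ, F) ∞ ψ (f x) :=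
    contMDiffAt_of_mem_maximalAtlas hψ (hmaps x hx)
  have hτs : ContMDiffAt 𝓘(ℝ, F) 𝓘(ℝ, E) ∞ τ (f x) := by
    have h : ContDiff ℝ ∞ (fun w : F => φ x + R (w - ψ (f x))) := by fun_prop
    exact ContMDiffAt.comp (g := fun w : F => φ x + R (w - ψ (f x))) (f x)
      h.contMDiff.contMDiffAt hψs
  have hφs : ContMDiffAt 𝓘(ℝ, E) 𝓘(ℝ, E) ∞ φ.symm (φ x) :=
    contMDiffAt_symm_of_mem_maximalAtlas hφ (φ.map_source hx)
  refine ⟨fun y => φ.symm (τ y), ContMDiffAt.comp_of_eq hφs hτs hτx, ?_, ?_⟩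
  · simp only [hτx, φ.left_inv hx]
  · have h1 : ∀ᶠ y in 𝓝 (f x), τ y ∈ φ.target := by
      refine hτs.continuousAt.preimage_mem_nhds (φ.open_target.mem_nhds ?_)
      rw [hτx]
      exact φ.map_source hx
    filter_upwards [h1, ψ.open_source.mem_nhds (hmaps x hx)] with y hy hys
    refine ψ.injOn (hmaps _ (φ.map_target hy)) hys ?_
    rw [hL _ hy]
    simp [hτ, hLR, hLx]

omit [IsManifold 𝓘(ℝ, E) ∞ M] [IsManifold 𝓘(ℝ, F) ∞ N] in
theorem tder_submersion_surjective (hf : Manifold.IsSubmersion 𝓘(ℝ, E) 𝓘(ℝ, F) ∞ f) (x : M) :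
    Function.Surjective (tder E F f x) := by
  obtain ⟨σ, hσ, hσx, hfσ⟩ := exists_local_section hf x
  have h := tder_comp (hf.contMDiff.mdifferentiableAt (by simp))
    (hσ.mdifferentiableAt (by simp)) hσx
  rw [tder_congr hfσ, tder_id] at h
  exact fun w => ⟨tder F E σ (f x) w, (DFunLike.congr_fun h w).symm⟩

omit [IsManifold 𝓘(ℝ, E) ∞ M] [IsManifold 𝓘(ℝ, F) ∞ N] in
/-- Every vector in the kernel of the derivative of a submersion is tangent to a smooth curve in
the fibre. -/
theorem exists_curve_in_fibre (hf : Manifold.IsSubmersion 𝓘(ℝ, E) 𝓘(ℝ, F) ∞ f) (x : M) {v : E}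
    (hv : tder E F f x v = 0) :
    ∃ c : ℝ → M, ContMDiff 𝓘(ℝ, ℝ) 𝓘(ℝ, E) ∞ c ∧ (∀ t, f (c t) = f x) ∧ c 0 = x ∧
      velocity E c 0 = v := by
  obtain ⟨φ, ψ, L, R, hφ, hψ, hx, hmaps, hL, hLR⟩ := exists_submersion_normal_form hf x
  have hφx := φ.map_source hx
  have hφd : MDifferentiableAt 𝓘(ℝ, E) 𝓘(ℝ, E) φ x :=
    (contMDiffAt_of_mem_maximalAtlas hφ hx).mdifferentiableAt (by simp)
  have hφs : ∀ z ∈ φ.target, ContMDiffAt 𝓘(ℝ, E) 𝓘(ℝ, E) ∞ φ.symm z := fun z hz =>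
    contMDiffAt_symm_of_mem_maximalAtlas hφ hz
  set w : E := tder E E φ x v with hw
  have hinv : tder E E φ.symm (φ x) w = v := by
    have h := tder_comp ((hφs _ hφx).mdifferentiableAt (by simp)) hφd rfl
    have e : (fun z => φ.symm (φ z)) =ᶠ[𝓝 x] fun z => z := by
      filter_upwards [φ.open_source.mem_nhds hx] with z hz using φ.left_inv hz
    rw [tder_congr e, tder_id] at h
    exact (DFunLike.congr_fun h v).symm
  have hLw : L w = 0 := by
    have hψd : MDifferentiableAt 𝓘(ℝ, F) 𝓘(ℝ, F) ψ (f x) :=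
      (contMDiffAt_of_mem_maximalAtlas hψ (hmaps x hx)).mdifferentiableAt (by simp)
    have hfd : MDifferentiableAt 𝓘(ℝ, E) 𝓘(ℝ, F) f x := hf.contMDiff.mdifferentiableAt (by simp)
    have h1 := tder_comp hψd hfd rfl
    have h2 := tder_comp (E := E) (f := φ) (x := x) (g := L)
      (L.contDiff.contMDiff (n := 1) |>.mdifferentiableAt (by simp)) hφd rfl
    have e : (fun z => ψ (f z)) =ᶠ[𝓝 x] fun z => L (φ z) := by
      filter_upwards [φ.open_source.mem_nhds hx] with z hz
      rw [← hL _ (φ.map_source hz), φ.left_inv hz]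
    rw [← tder_congr e, h1, tder_eq_fderiv, L.fderiv] at h2
    have h3 := DFunLike.congr_fun h2 v
    simp only [ContinuousLinearMap.comp_apply, hv, map_zero] at h3
    exact h3.symm
  obtain ⟨δ, hδ, hball⟩ := Metric.isOpen_iff.1 φ.open_target _ hφx
  -- The curve must stay in the chart for all times. Replacing the segment parameter `t` by `ε
  -- sin(t/ε)` keeps the derivative `1` at `0` and bounds the displacement by `ε ‖w‖ ≤ δ/2`.
  set ε : ℝ := δ / (2 * (‖w‖ + 1)) with hε
  have hw0 : 0 ≤ ‖w‖ := norm_nonneg w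
  have hεpos : 0 < ε := by positivity
  set τ : ℝ → E := fun t => φ x + (ε * Real.sin (t / ε)) • w with hτ
  have hτt : ∀ t, τ t ∈ φ.target := by
    intro t
    apply hball
    rw [Metric.mem_ball, dist_eq_norm, hτ, add_sub_cancel_left, norm_smul, Real.norm_eq_abs,
      abs_mul, abs_of_pos hεpos]
    have h1 : ε * |Real.sin (t / ε)| * ‖w‖ ≤ ε * 1 * (‖w‖ + 1) := by
      gcongr
      · exact Real.abs_sin_le_one _
      · linarith
    have h2 : ε * 1 * (‖w‖ + 1) = δ / 2 := by rw [hε]; field_simp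
    linarith
  have hτs : ContDiff ℝ ∞ τ := by
    refine contDiff_const.add ((contDiff_const.mul ?_).smul contDiff_const)
    exact Real.contDiff_sin.comp (contDiff_id.div_const ε)
  have hτ0 : τ 0 = φ x := by simp [hτ]
  have hτd : velocity E τ 0 = w := by
    rw [velocity_eq_deriv]
    have h1 : HasDerivAt (fun t : ℝ => t / ε) (1 / ε) 0 := (hasDerivAt_id 0).div_const ε
    have h2 := ((h1.sin.const_mul ε).smul_const w).const_add (φ x)
    rw [h2.deriv]
    simp [hεpos.ne']
  refine ⟨fun t => φ.symm (τ t), fun t => ContMDiffAt.comp t (hφs _ (hτt t))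
    hτs.contMDiff.contMDiffAt, fun t => ?_, by simp only [hτ0, φ.left_inv hx], ?_⟩
  · refine ψ.injOn (hmaps _ (φ.map_target (hτt t))) (hmaps x hx) ?_
    rw [hL _ (hτt t)]
    have h1 : ψ (f x) = L (φ x) := by rw [← hL _ hφx, φ.left_inv hx]
    simp [hτ, hLw, h1]
  · rw [velocity_comp ((hφs _ hφx).mdifferentiableAt (by simp))
      (hτs.contMDiff.mdifferentiableAt (by simp)) hτ0, hτd, hinv]

end Submersion

/-! ### Topology and smooth action on `G/K` -/

section Homogeneous

variable {E : Type*} [NormedAddCommGroup E] [NormedSpace ℝ E]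
  {G : Type*} [TopologicalSpace G] [ChartedSpace E G] [Group G] [LieGroup 𝓘(ℝ, E) ∞ G]
  {K : Subgroup G}

-- The quotient map is open, so it suffices that the coset relation is closed; it is the preimage of
-- `K` under `(x, y) ↦ x⁻¹y`.
omit [ChartedSpace E G] [LieGroup 𝓘(ℝ, E) ∞ G] in
theorem t2Space_quotient [IsTopologicalGroup G] (hK : IsClosed (K : Set G)) :
    T2Space (G ⧸ K) := by
  rw [t2Space_iff_of_isOpenQuotientMap (QuotientGroup.isOpenQuotientMap_mk (N := K))]
  have : {q : G × G | (QuotientGroup.mk q.1 : G ⧸ K) = QuotientGroup.mk q.2}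
      = (fun q : G × G => q.1⁻¹ * q.2) ⁻¹' (K : Set G) := by
    ext q
    exact QuotientGroup.eq
  rw [this]
  exact hK.preimage (by fun_prop)

variable {F : Type*} [NormedAddCommGroup F] [NormedSpace ℝ F]
  [ChartedSpace F (G ⧸ K)] [IsManifold 𝓘(ℝ, F) ∞ (G ⧸ K)]

-- Near any point the action is `(a, q) ↦ π(a σ(q))` for a smooth local section `σ`.
omit [IsManifold 𝓘(ℝ, F) ∞ (G ⧸ K)] in
theorem contMDiff_action
    (hπ : Manifold.IsSubmersion 𝓘(ℝ, E) 𝓘(ℝ, F) ∞ (QuotientGroup.mk : G → G ⧸ K)) :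
    ContMDiff (𝓘(ℝ, E).prod 𝓘(ℝ, F)) 𝓘(ℝ, F) ∞ (fun p : G × (G ⧸ K) => p.1 • p.2) := by
  rintro ⟨a, q⟩
  obtain ⟨x, rfl⟩ := QuotientGroup.mk_surjective q
  obtain ⟨σ, hσ, hσx, hπσ⟩ := exists_local_section hπ x
  have h1 : ContMDiffAt (𝓘(ℝ, E).prod 𝓘(ℝ, F)) 𝓘(ℝ, E) ∞ (fun p : G × (G ⧸ K) => p.1 * σ p.2)
      (a, (x : G ⧸ K)) :=
    contMDiffAt_fst.mul (ContMDiffAt.comp (a, (x : G ⧸ K)) hσ contMDiffAt_snd)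
  refine (ContMDiffAt.comp _ hπ.contMDiff.contMDiffAt h1).congr_of_eventuallyEq ?_
  have h2 : ∀ᶠ p : G × (G ⧸ K) in 𝓝 (a, (x : G ⧸ K)), (σ p.2 : G ⧸ K) = p.2 :=
    (continuous_snd.tendsto (a, (x : G ⧸ K))).eventually hπσ
  filter_upwards [h2] with p hp
  exact congrArg (p.1 • ·) hp.symm

omit [IsManifold 𝓘(ℝ, F) ∞ (G ⧸ K)] in
theorem contMDiff_smul_left
    (hπ : Manifold.IsSubmersion 𝓘(ℝ, E) 𝓘(ℝ, F) ∞ (QuotientGroup.mk : G → G ⧸ K)) (a : G) :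
    ContMDiff 𝓘(ℝ, F) 𝓘(ℝ, F) ∞ (fun q : G ⧸ K => a • q) :=
  (contMDiff_action hπ).comp (contMDiff_const.prodMk contMDiff_id)

omit [IsManifold 𝓘(ℝ, F) ∞ (G ⧸ K)] in
/-- The kernel of the differential of the projection is the Lie algebra of the subgroup. -/
theorem tder_mk_eq_zero_iff
    (hπ : Manifold.IsSubmersion 𝓘(ℝ, E) 𝓘(ℝ, F) ∞ (QuotientGroup.mk : G → G ⧸ K)) {X : E} :
    tder E F (QuotientGroup.mk : G → G ⧸ K) 1 X = 0 ↔ X ∈ (lieAlgebraOf K : Submodule ℝ E) := by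
  rw [mem_lieAlgebraOf]
  constructor
  · intro h
    -- The fibre of `π` through `1` is `K`, so a kernel vector is the velocity of a curve in `K`.
    obtain ⟨c, hc, hcf, hc0, hcv⟩ := exists_curve_in_fibre hπ 1 h
    refine ⟨c, hc, fun t => ?_, hc0, hcv⟩
    have := QuotientGroup.eq.1 (hcf t).symm
    simpa using this
  · rintro ⟨c, hc, hcK, hc0, rfl⟩
    rw [← velocity_comp (hπ.contMDiff.mdifferentiableAt (by simp))
      (hc.mdifferentiableAt (by simp)) hc0]
    have e : (fun s => (c s : G ⧸ K)) = fun _ => ((1 : G) : G ⧸ K) := by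
      funext s
      exact (QuotientGroup.eq.2 (by simpa using hcK s)).symm
    rw [e, velocity_eq_tder, tder_const]
    rfl

end Homogeneous

end TwoStepGO

end

noncomputable section

namespace TwoStepGO

/-! ### Boundedness of unit balls of inner products -/

section PosDef

variable {E : Type*} [NormedAddCommGroup E] [NormedSpace ℝ E] [FiniteDimensional ℝ E]

theorem isVonNBounded_of_pos {B : E →L[ℝ] E →L[ℝ] ℝ} (hB : ∀ u, u ≠ 0 → 0 < B u u) :
    Bornology.IsVonNBounded ℝ {v : E | B v v < 1} := by
  have hcont : Continuous (fun v : E => B v v) := by fun_prop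
  have : ProperSpace E := FiniteDimensional.proper ℝ E
  obtain ⟨c, hc, hle⟩ := (isCompact_sphere (0 : E) 1).exists_forall_le' hcont.continuousOn
    (a := 0) fun u hu => hB u (by rintro rfl; simp at hu)
  rw [NormedSpace.isVonNBounded_iff']
  -- With `B v v ≥ c ‖v‖²`, a norm above `1 + 1/c` makes both `‖v‖` and `c ‖v‖` exceed `1`, hence `B
  -- v v > 1`.
  refine ⟨1 + 1 / c, fun v (hv : B v v < 1) => ?_⟩
  rcases eq_or_ne v 0 with rfl | hne
  · simp; positivity
  have hn : 0 < ‖v‖ := norm_pos_iff.2 hne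
  have h1 := hle (‖v‖⁻¹ • v) (by simp [norm_smul, hn.ne'])
  simp only [map_smul, _root_.smul_apply, smul_eq_mul] at h1
  have h2 : c * ‖v‖ ^ 2 ≤ B v v := by
    have := mul_le_mul_of_nonneg_right h1 (sq_nonneg ‖v‖)
    refine this.trans_eq ?_
    field_simp
  by_contra! hlt
  have h3 : 1 < c * ‖v‖ := by
    have := mul_lt_mul_of_pos_left hlt hc
    rw [mul_add, mul_one_div_cancel hc.ne'] at this
    linarith
  have h4 : 1 < ‖v‖ := by
    have : 0 < 1 / c := by positivity
    linarith
  nlinarith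

end PosDef

/-! ### Derivatives of the action and of orbit maps -/

section Action

variable {E : Type*} [NormedAddCommGroup E] [NormedSpace ℝ E]
  {G : Type*} [TopologicalSpace G] [ChartedSpace E G] [Group G] [LieGroup 𝓘(ℝ, E) ∞ G]
  {K : Subgroup G}
  {F : Type*} [NormedAddCommGroup F] [NormedSpace ℝ F]
  [ChartedSpace F (G ⧸ K)]
  (hπ : Manifold.IsSubmersion 𝓘(ℝ, E) 𝓘(ℝ, F) ∞ (QuotientGroup.mk : G → G ⧸ K))

include hπ

omit [LieGroup 𝓘(ℝ, E) ∞ G] in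
theorem mdifferentiableAt_mk (x : G) :
    MDifferentiableAt 𝓘(ℝ, E) 𝓘(ℝ, F) (QuotientGroup.mk : G → G ⧸ K) x :=
  hπ.contMDiff.mdifferentiableAt (by simp)

theorem mdifferentiableAt_smul_left (a : G) (q : G ⧸ K) :
    MDifferentiableAt 𝓘(ℝ, F) 𝓘(ℝ, F) (fun q : G ⧸ K => a • q) q :=
  (contMDiff_smul_left hπ a).mdifferentiableAt (by simp)

theorem tder_mul_smul (a b : G) (q : G ⧸ K) :
    tder F F (fun q : G ⧸ K => (a * b) • q) q
      = (tder F F (fun q : G ⧸ K => a • q) (b • q)).comp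
        (tder F F (fun q : G ⧸ K => b • q) q) := by
  simp only [mul_smul]
  exact tder_comp (mdifferentiableAt_smul_left hπ a _) (mdifferentiableAt_smul_left hπ b _) rfl

theorem tder_smul_inv_comp (a : G) (q : G ⧸ K) :
    (tder F F (fun q : G ⧸ K => a⁻¹ • q) (a • q)).comp (tder F F (fun q : G ⧸ K => a • q) q)
      = ContinuousLinearMap.id ℝ F := by
  rw [← tder_mul_smul hπ, inv_mul_cancel, ← tder_id q]
  simp only [one_smul]

theorem tder_smul_surjective (a : G) (q : G ⧸ K) :
    Function.Surjective (tder F F (fun q : G ⧸ K => a • q) q) := by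
  have h := tder_smul_inv_comp hπ a⁻¹ (a • q)
  rw [inv_inv, inv_smul_smul] at h
  exact fun v => ⟨_, DFunLike.congr_fun h v⟩

/-- The isotropy representation is induced by `Ad`: for `a ∈ K` the cosets of `ax` and `axa⁻¹`
agree. -/
theorem tder_smul_mk_one {a : G} (ha : a ∈ K) (X : E) :
    tder F F (fun q : G ⧸ K => a • q) ((1 : G) : G ⧸ K)
        (tder E F (QuotientGroup.mk : G → G ⧸ K) 1 X)
      = tder E F (QuotientGroup.mk : G → G ⧸ K) 1 (Ad E a X) := by
  have h1 := tder_comp (mdifferentiableAt_smul_left hπ a ((1 : G) : G ⧸ K))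
    (mdifferentiableAt_mk hπ (1 : G)) rfl
  have h2 := tder_comp (mdifferentiableAt_mk hπ (1 : G)) (mdifferentiableAt_conj E a 1) (by simp)
  have e : (fun x : G => a • (x : G ⧸ K)) = fun x => ((a * x * a⁻¹ : G) : G ⧸ K) := by
    funext x
    refine QuotientGroup.eq.2 ?_
    show (a * x)⁻¹ * (a * x * a⁻¹) ∈ K
    rw [inv_mul_cancel_left]
    exact K.inv_mem ha
  rw [e, h2] at h1
  exact (DFunLike.congr_fun h1 X).symm

/-- The derivative of the orbit map `a ↦ a • xK`. -/
theorem tder_orbit (x : G) (Z : E) :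
    tder E F (fun a : G => a • (x : G ⧸ K)) 1 Z
      = tder F F (fun q : G ⧸ K => x • q) ((1 : G) : G ⧸ K)
        (tder E F (QuotientGroup.mk : G → G ⧸ K) 1 (Ad E x⁻¹ Z)) := by
  have h1 := tder_comp (mdifferentiableAt_mk hπ (1 : G)) (mdifferentiableAt_conj E x⁻¹ 1)
    (by simp)
  have hd : MDifferentiableAt 𝓘(ℝ, E) 𝓘(ℝ, F)
      (fun a : G => ((x⁻¹ * a * x⁻¹⁻¹ : G) : G ⧸ K)) 1 :=
    (mdifferentiableAt_mk hπ _).comp (1 : G) (mdifferentiableAt_conj E x⁻¹ 1)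
  have h2 := tder_comp (mdifferentiableAt_smul_left hπ x ((1 : G) : G ⧸ K)) hd (by simp)
  have e : (fun a : G => x • ((x⁻¹ * a * x⁻¹⁻¹ : G) : G ⧸ K)) = fun a => a • (x : G ⧸ K) := by
    funext a
    refine congrArg (QuotientGroup.mk : G → G ⧸ K) ?_
    simp [mul_assoc]
  rw [e, h1] at h2
  exact DFunLike.congr_fun h2 Z

end Action

/-! ### The deformed form on the Lie algebra and its decomposition -/

section Deformed

variable {E : Type*} [NormedAddCommGroup E] [NormedSpace ℝ E]
  {G : Type*} [TopologicalSpace G] [ChartedSpace E G] [Group G] [LieGroup 𝓘(ℝ, E) ∞ G]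
  (b : SmoothMetric E G) (K H : Subgroup G)

/-- The orthogonal projection to the Lie algebra of a subgroup. -/
def projLie : E →L[ℝ] E := orthProj (metForm b 1) (lieAlgebraOf K : Submodule ℝ E)

/-- The projection to `𝔪₁`. -/
def projOne : E →L[ℝ] E := ContinuousLinearMap.id ℝ E - projLie b H

/-- The projection to `𝔪₂`. -/
def projTwo : E →L[ℝ] E := projLie b H - projLie b K

/-- The bilinear form on the Lie algebra which is zero on `𝔨` and the deformed inner product on
`𝔪₁ ⊕ 𝔪₂`. -/
def deformedForm (lam : ℝ) : E →L[ℝ] E →L[ℝ] ℝ :=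
  pullForm (metForm b 1) (projOne b H) + lam • pullForm (metForm b 1) (projTwo b K H)

theorem deformedForm_apply (lam : ℝ) (X Y : E) : deformedForm b K H lam X Y
    = metForm b 1 (projOne b H X) (projOne b H Y)
      + lam * metForm b 1 (projTwo b K H X) (projTwo b K H Y) := rfl

variable {b K H}

theorem mem_orthCompl {V : Submodule ℝ E} {X : E} :
    X ∈ (orthCompl b V : Submodule ℝ E) ↔ ∀ Y ∈ V, metForm b 1 X Y = 0 := Iff.rfl

theorem metForm_pos_one : ∀ u : E, u ≠ 0 → 0 < metForm b (1 : G) u u :=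
  fun _ hu => metForm_pos b 1 hu

theorem projLie_mem (X : E) : projLie b K X ∈ (lieAlgebraOf K : Submodule ℝ E) :=
  orthProj_mem X

theorem lieAlgebraOf_mono (hKH : K ≤ H) {X : E} (hX : X ∈ (lieAlgebraOf K : Submodule ℝ E)) :
    X ∈ (lieAlgebraOf H : Submodule ℝ E) := by
  obtain ⟨c, hc, hcK, hc0, hcv⟩ := mem_lieAlgebraOf.1 hX
  exact mem_lieAlgebraOf.2 ⟨c, hc, fun t => hKH (hcK t), hc0, hcv⟩

theorem projOne_add_projTwo (X : E) :
    projOne b H X + projTwo b K H X = X - projLie b K X := by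
  simp [projOne, projTwo]

theorem deformedForm_symm (lam : ℝ) (X Y : E) :
    deformedForm b K H lam X Y = deformedForm b K H lam Y X := by
  simp only [deformedForm_apply]
  rw [metForm_symm, metForm_symm b 1 (projTwo b K H X)]

theorem mOne_le (hKH : K ≤ H) {X : E} (hX : X ∈ (mOne b H : Submodule ℝ E)) :
    X ∈ (orthCompl b (lieAlgebraOf K) : Submodule ℝ E) :=
  fun Y hY => hX Y (lieAlgebraOf_mono (E := E) hKH hY)

variable [FiniteDimensional ℝ E]

theorem projLie_spec (X : E) {Y : E} (hY : Y ∈ (lieAlgebraOf K : Submodule ℝ E)) :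
    metForm b 1 (projLie b K X) Y = metForm b 1 X Y :=
  orthProj_spec metForm_pos_one X hY

theorem projOne_mem (X : E) : projOne b H X ∈ (mOne b H : Submodule ℝ E) := by
  refine mem_orthCompl.2 fun Y hY => ?_
  have h : metForm b 1 (X - projLie b H X) Y
      = metForm b 1 X Y - metForm b 1 (projLie b H X) Y := by rw [map_sub]; rfl
  exact h.trans (by rw [projLie_spec X hY, sub_self])

theorem projTwo_mem (hKH : K ≤ H) (X : E) :
    projTwo b K H X ∈ (mTwo b K H : Submodule ℝ E) := by
  have hK : projLie b K X ∈ (lieAlgebraOf H : Submodule ℝ E) :=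
    lieAlgebraOf_mono hKH (projLie_mem X)
  refine ⟨Submodule.sub_mem _ (projLie_mem X) hK, mem_orthCompl.2 fun Y hY => ?_⟩
  have h : metForm b 1 (projLie b H X - projLie b K X) Y
      = metForm b 1 (projLie b H X) Y - metForm b 1 (projLie b K X) Y := by rw [map_sub]; rfl
  exact h.trans (by rw [projLie_spec X hY, projLie_spec X (lieAlgebraOf_mono hKH hY), sub_self])

theorem projLie_of_mem {X : E} (hX : X ∈ (lieAlgebraOf K : Submodule ℝ E)) :
    projLie b K X = X := orthProj_of_mem metForm_pos_one hX

theorem projLie_of_orth {X : E} (hX : X ∈ (orthCompl b (lieAlgebraOf K) : Submodule ℝ E)) :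
    projLie b K X = 0 := orthProj_of_orth metForm_pos_one (mem_orthCompl.1 hX)

theorem projOne_decomp (hKH : K ≤ H) {X₁ X₂ Z : E} (h₁ : X₁ ∈ (mOne b H : Submodule ℝ E))
    (h₂ : X₂ ∈ (mTwo b K H : Submodule ℝ E)) (hZ : Z ∈ (lieAlgebraOf K : Submodule ℝ E)) :
    projOne b H (X₁ + X₂ + Z) = X₁ := by
  have e : projLie b H (X₁ + X₂ + Z) = X₂ + Z := by
    rw [map_add, map_add, projLie_of_orth h₁, projLie_of_mem h₂.1,
      projLie_of_mem (lieAlgebraOf_mono hKH hZ), zero_add]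
  show X₁ + X₂ + Z - projLie b H (X₁ + X₂ + Z) = X₁
  rw [e]
  abel

theorem projTwo_decomp (hKH : K ≤ H) {X₁ X₂ Z : E} (h₁ : X₁ ∈ (mOne b H : Submodule ℝ E))
    (h₂ : X₂ ∈ (mTwo b K H : Submodule ℝ E)) (hZ : Z ∈ (lieAlgebraOf K : Submodule ℝ E)) :
    projTwo b K H (X₁ + X₂ + Z) = X₂ := by
  have e : projLie b K (X₁ + X₂ + Z) = Z := by
    rw [map_add, map_add, projLie_of_orth (mOne_le hKH h₁), projLie_of_orth h₂.2,
      projLie_of_mem hZ, zero_add, zero_add]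
  have h := projOne_add_projTwo (b := b) (K := K) (H := H) (X₁ + X₂ + Z)
  rw [projOne_decomp hKH h₁ h₂ hZ, e] at h
  have h' : X₁ + projTwo b K H (X₁ + X₂ + Z) = X₁ + X₂ := h.trans (add_sub_cancel_right _ _)
  exact add_left_cancel h'

theorem projOne_of_mem (hKH : K ≤ H) {Z : E} (hZ : Z ∈ (lieAlgebraOf K : Submodule ℝ E)) :
    projOne b H Z = 0 := by
  have h := projOne_decomp (b := b) (X₁ := (0 : E)) (X₂ := (0 : E)) hKH (Submodule.zero_mem _) (Submodule.zero_mem _) hZ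
  rwa [add_zero, zero_add] at h

theorem projTwo_of_mem (hKH : K ≤ H) {Z : E} (hZ : Z ∈ (lieAlgebraOf K : Submodule ℝ E)) :
    projTwo b K H Z = 0 := by
  have h := projTwo_decomp (b := b) (X₁ := (0 : E)) (X₂ := (0 : E)) hKH (Submodule.zero_mem _) (Submodule.zero_mem _) hZ
  rwa [add_zero, zero_add] at h

theorem projOne_add (hKH : K ≤ H) {X₁ X₂ : E} (h₁ : X₁ ∈ (mOne b H : Submodule ℝ E))
    (h₂ : X₂ ∈ (mTwo b K H : Submodule ℝ E)) : projOne b H (X₁ + X₂) = X₁ := by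
  have h := projOne_decomp (Z := (0 : E)) hKH h₁ h₂ (Submodule.zero_mem _)
  rwa [add_zero] at h

theorem projTwo_add (hKH : K ≤ H) {X₁ X₂ : E} (h₁ : X₁ ∈ (mOne b H : Submodule ℝ E))
    (h₂ : X₂ ∈ (mTwo b K H : Submodule ℝ E)) : projTwo b K H (X₁ + X₂) = X₂ := by
  have h := projTwo_decomp (Z := (0 : E)) hKH h₁ h₂ (Submodule.zero_mem _)
  rwa [add_zero] at h

theorem deformedForm_add (hKH : K ≤ H) (lam : ℝ) {X₁ X₂ Y₁ Y₂ : E}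
    (h₁ : X₁ ∈ (mOne b H : Submodule ℝ E)) (h₂ : X₂ ∈ (mTwo b K H : Submodule ℝ E))
    (k₁ : Y₁ ∈ (mOne b H : Submodule ℝ E)) (k₂ : Y₂ ∈ (mTwo b K H : Submodule ℝ E)) :
    deformedForm b K H lam (X₁ + X₂) (Y₁ + Y₂)
      = metForm b 1 X₁ Y₁ + lam * metForm b 1 X₂ Y₂ := by
  rw [deformedForm_apply, projOne_add hKH h₁ h₂, projOne_add hKH k₁ k₂, projTwo_add hKH h₁ h₂,
    projTwo_add hKH k₁ k₂]

theorem projLie_Ad (hb : IsBiInvariant b) {a : G} (ha : a ∈ H) (X : E) :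
    projLie b H (Ad E a X) = Ad E a (projLie b H X) :=
  orthProj_comm metForm_pos_one (hb.metForm_Ad a) (fun _ => Ad_mem_lieAlgebraOf ha)
    (fun _ => Ad_mem_lieAlgebraOf (H.inv_mem ha)) (Ad_apply_inv E a) X

/-- As `a ∈ K ⊆ H`, `Ad(a)` is orthogonal and preserves `𝔨` and `𝔥`, so it commutes with the
projections to `𝔪₁` and `𝔪₂`. -/
theorem deformedForm_Ad (hb : IsBiInvariant b) (hKH : K ≤ H) (lam : ℝ) {a : G} (ha : a ∈ K)
    (X Y : E) : deformedForm b K H lam (Ad E a X) (Ad E a Y) = deformedForm b K H lam X Y := by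
  have h1 : ∀ X : E, projOne b H (Ad E a X) = Ad E a (projOne b H X) := fun X => by
    simp [projOne, projLie_Ad hb (hKH ha)]
  have h2 : ∀ X : E, projTwo b K H (Ad E a X) = Ad E a (projTwo b K H X) := fun X => by
    simp [projTwo, projLie_Ad hb (hKH ha), projLie_Ad hb ha]
  simp only [deformedForm_apply, h1, h2, hb.metForm_Ad]

-- If both projections of `X` vanished, `X` would equal its projection to `𝔨`.
omit [FiniteDimensional ℝ E] in
theorem deformedForm_pos {lam : ℝ} (hlam : 0 < lam) {X : E}
    (hX : X ∉ (lieAlgebraOf K : Submodule ℝ E)) : 0 < deformedForm b K H lam X X := by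
  rw [deformedForm_apply]
  have hnn : ∀ u : E, 0 ≤ metForm b (1 : G) u u := fun u => by
    rcases eq_or_ne u 0 with rfl | hu
    · simp
    · exact (metForm_pos_one u hu).le
  by_cases h1 : projOne b H X = 0
  · have h2 : projTwo b K H X ≠ 0 := by
      intro h2
      have h := projOne_add_projTwo (b := b) (K := K) (H := H) X
      rw [h1, h2, add_zero, eq_comm, sub_eq_zero] at h
      exact hX (h ▸ projLie_mem X)
    have := mul_pos hlam (metForm_pos_one (b := b) _ h2)
    linarith [hnn (projOne b H X)]
  · have := metForm_pos_one (b := b) _ h1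
    have := mul_nonneg hlam.le (hnn (projTwo b K H X))
    linarith

end Deformed

end TwoStepGO

end

noncomputable section

namespace TwoStepGO

/-! ### Existence and uniqueness of the deformed metric -/

section DeformedMetric

variable {E : Type*} [NormedAddCommGroup E] [NormedSpace ℝ E] [FiniteDimensional ℝ E]
  {G : Type*} [TopologicalSpace G] [ChartedSpace E G] [Group G] [LieGroup 𝓘(ℝ, E) ∞ G]
  {b : SmoothMetric E G} {K H : Subgroup G}
  {F : Type*} [NormedAddCommGroup F] [NormedSpace ℝ F] [ChartedSpace F (G ⧸ K)]

omit [FiniteDimensional ℝ E] [LieGroup 𝓘(ℝ, E) ∞ G] [ChartedSpace E G] in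
theorem IsInvariantMetric.metForm_smul [IsManifold 𝓘(ℝ, F) ∞ (G ⧸ K)] {g : SmoothMetric F (G ⧸ K)}
    (hg : IsInvariantMetric G g) (a : G) (q : G ⧸ K) (u v : F) :
    metForm g (a • q) (tder F F (fun q : G ⧸ K => a • q) q u)
      (tder F F (fun q : G ⧸ K => a • q) q v) = metForm g q u v := hg a q u v

section Decomposition

variable (hKH : K ≤ H)
  (hπ : Manifold.IsSubmersion 𝓘(ℝ, E) 𝓘(ℝ, F) ∞ (QuotientGroup.mk : G → G ⧸ K))

include hπ

omit [FiniteDimensional ℝ E] in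
theorem tder_mk_projOne_add_projTwo (X : E) :
    tder E F (QuotientGroup.mk : G → G ⧸ K) 1 (projOne b H X + projTwo b K H X)
      = tder E F (QuotientGroup.mk : G → G ⧸ K) 1 X := by
  rw [projOne_add_projTwo, map_sub, (tder_mk_eq_zero_iff hπ).2 (projLie_mem X), sub_zero]

include hKH

theorem projOne_projTwo_eq {X Y : E} (h : tder E F (QuotientGroup.mk : G → G ⧸ K) 1 X
      = tder E F (QuotientGroup.mk : G → G ⧸ K) 1 Y) :
    projOne b H X = projOne b H Y ∧ projTwo b K H X = projTwo b K H Y := by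
  have hZ : X - Y ∈ (lieAlgebraOf K : Submodule ℝ E) := by
    rw [← tder_mk_eq_zero_iff hπ, map_sub, h, sub_self]
  constructor
  · rw [← sub_eq_zero, ← map_sub, projOne_of_mem hKH hZ]
  · rw [← sub_eq_zero, ← map_sub, projTwo_of_mem hKH hZ]

/-- The projections to `𝔪₁` and `𝔪₂` vanish on `𝔨 = ker dπ`, so they depend only on the image under
`dπ`, which is surjective. -/
theorem existsUnique_decomposition (v : F) :
    ∃! X : E × E, X.1 ∈ (mOne b H : Submodule ℝ E) ∧ X.2 ∈ (mTwo b K H : Submodule ℝ E) ∧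
      tder E F (QuotientGroup.mk : G → G ⧸ K) 1 (X.1 + X.2) = v := by
  obtain ⟨X, rfl⟩ := tder_submersion_surjective hπ 1 v
  refine ⟨(projOne b H X, projTwo b K H X), ⟨projOne_mem X, projTwo_mem hKH X,
    tder_mk_projOne_add_projTwo hπ X⟩, ?_⟩
  rintro ⟨X₁, X₂⟩ ⟨h₁, h₂, h⟩
  obtain ⟨k₁, k₂⟩ := projOne_projTwo_eq (b := b) hKH hπ h
  exact Prod.ext ((projOne_add hKH h₁ h₂).symm.trans k₁) ((projTwo_add hKH h₁ h₂).symm.trans k₂)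

theorem deformedForm_congr (lam : ℝ) {X X' Y Y' : E}
    (hX : tder E F (QuotientGroup.mk : G → G ⧸ K) 1 X
      = tder E F (QuotientGroup.mk : G → G ⧸ K) 1 X')
    (hY : tder E F (QuotientGroup.mk : G → G ⧸ K) 1 Y
      = tder E F (QuotientGroup.mk : G → G ⧸ K) 1 Y') :
    deformedForm b K H lam X Y = deformedForm b K H lam X' Y' := by
  obtain ⟨h1, h2⟩ := projOne_projTwo_eq (b := b) hKH hπ hX
  obtain ⟨k1, k2⟩ := projOne_projTwo_eq (b := b) hKH hπ hY
  simp only [deformedForm_apply, h1, h2, k1, k2]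

/-- The inner product on `T_o(G/K)` defining the deformed metric. -/
theorem exists_originForm (lam : ℝ) : ∃ q : F →L[ℝ] F →L[ℝ] ℝ, ∀ X Y : E,
    q (tder E F (QuotientGroup.mk : G → G ⧸ K) 1 X)
      (tder E F (QuotientGroup.mk : G → G ⧸ K) 1 Y) = deformedForm b K H lam X Y := by
  set T := tder E F (QuotientGroup.mk : G → G ⧸ K) 1 with hT
  have hs : Function.Surjective T := tder_submersion_surjective hπ 1
  have : FiniteDimensional ℝ F := FiniteDimensional.of_surjective (T : E →ₗ[ℝ] F) hs
  -- Any linear section of `dπ` serves: the form does not change when its arguments move within `𝔨`.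
  obtain ⟨s, hs⟩ := LinearMap.exists_rightInverse_of_surjective (T : E →ₗ[ℝ] F)
    (LinearMap.range_eq_top.2 hs)
  refine ⟨pullForm (deformedForm b K H lam) (LinearMap.toContinuousLinearMap s), fun X Y => ?_⟩
  exact deformedForm_congr hKH hπ lam (DFunLike.congr_fun hs (T X)) (DFunLike.congr_fun hs (T Y))

end Decomposition

section Invariant

variable [IsManifold 𝓘(ℝ, F) ∞ (G ⧸ K)] {lam : ℝ} {g g' : SmoothMetric F (G ⧸ K)}

theorem IsDeformedMetric.metForm_origin (hg : IsDeformedMetric b K H lam g) (hKH : K ≤ H)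
    (hπ : Manifold.IsSubmersion 𝓘(ℝ, E) 𝓘(ℝ, F) ∞ (QuotientGroup.mk : G → G ⧸ K)) (X Y : E) :
    metForm g ((1 : G) : G ⧸ K) (tder E F (QuotientGroup.mk : G → G ⧸ K) 1 X)
      (tder E F (QuotientGroup.mk : G → G ⧸ K) 1 Y) = deformedForm b K H lam X Y := by
  rw [← tder_mk_projOne_add_projTwo (b := b) (H := H) hπ X,
    ← tder_mk_projOne_add_projTwo (b := b) (H := H) hπ Y]
  exact hg.2 _ (projOne_mem X) _ (projTwo_mem hKH X) _ (projOne_mem Y) _ (projTwo_mem hKH Y)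

/-- Derivatives of translations and `dπ` are surjective, so invariance and the form at the origin
fix every inner product. -/
theorem IsDeformedMetric.unique (hg : IsDeformedMetric b K H lam g)
    (hg' : IsDeformedMetric b K H lam g') (hKH : K ≤ H)
    (hπ : Manifold.IsSubmersion 𝓘(ℝ, E) 𝓘(ℝ, F) ∞ (QuotientGroup.mk : G → G ⧸ K)) : g = g' := by
  have key : metForm g = metForm g' := by
    funext q
    obtain ⟨a, rfl⟩ := QuotientGroup.mk_surjective q
    have e : a • ((1 : G) : G ⧸ K) = (a : G ⧸ K) := congrArg QuotientGroup.mk (mul_one a)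
    rw [← e]
    ext u v
    obtain ⟨u, rfl⟩ := tder_smul_surjective hπ a ((1 : G) : G ⧸ K) u
    obtain ⟨v, rfl⟩ := tder_smul_surjective hπ a ((1 : G) : G ⧸ K) v
    obtain ⟨X, rfl⟩ := tder_submersion_surjective hπ 1 u
    obtain ⟨Y, rfl⟩ := tder_submersion_surjective hπ 1 v
    rw [hg.1.metForm_smul, hg'.1.metForm_smul, hg.metForm_origin hKH hπ,
      hg'.metForm_origin hKH hπ]
  cases g
  cases g'
  congr

end Invariant

section Existence

/-- The form at `q` obtained from a form at the origin by translation. -/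
def translateForm (q₀ : F →L[ℝ] F →L[ℝ] ℝ) (q : G ⧸ K) : F →L[ℝ] F →L[ℝ] ℝ :=
  pullForm q₀ (tder F F (fun x : G ⧸ K => q.out⁻¹ • x) q)

variable {lam : ℝ} {q₀ : F →L[ℝ] F →L[ℝ] ℝ}
  (hπ : Manifold.IsSubmersion 𝓘(ℝ, E) 𝓘(ℝ, F) ∞ (QuotientGroup.mk : G → G ⧸ K))

include hπ

-- Any representative `a` of the coset may replace the chosen one: they differ by an element of `K`,
-- under which `q₀` is invariant.
omit [FiniteDimensional ℝ E] in
theorem translateForm_mk (hq₀ : ∀ a ∈ K,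
      pullForm q₀ (tder F F (fun x : G ⧸ K => a • x) ((1 : G) : G ⧸ K)) = q₀) (a : G) :
    translateForm q₀ (a : G ⧸ K)
      = pullForm q₀ (tder F F (fun x : G ⧸ K => a⁻¹ • x) (a : G ⧸ K)) := by
  set c : G := Quotient.out (a : G ⧸ K) with hc
  have hac : a⁻¹ * c ∈ K := QuotientGroup.eq.1 (QuotientGroup.out_eq' (a : G ⧸ K)).symm
  have e1 : c⁻¹ • (a : G ⧸ K) = ((1 : G) : G ⧸ K) := by
    refine QuotientGroup.eq.2 ?_
    have := K.inv_mem (K.inv_mem hac)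
    simpa using this
  have e2 : a⁻¹ = (a⁻¹ * c) * c⁻¹ := by group
  have h := tder_mul_smul hπ (a⁻¹ * c) c⁻¹ (a : G ⧸ K)
  rw [← e2, e1] at h
  rw [h]
  conv_lhs => rw [← hq₀ _ hac]
  rfl

omit [FiniteDimensional ℝ E] in
theorem translateForm_smul (hq₀ : ∀ a ∈ K,
      pullForm q₀ (tder F F (fun x : G ⧸ K => a • x) ((1 : G) : G ⧸ K)) = q₀) (a : G)
    (q : G ⧸ K) : pullForm (translateForm q₀ (a • q)) (tder F F (fun x : G ⧸ K => a • x) q)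
      = translateForm q₀ q := by
  obtain ⟨x, rfl⟩ := QuotientGroup.mk_surjective q
  have e : a • (x : G ⧸ K) = ((a * x : G) : G ⧸ K) := rfl
  have h := tder_mul_smul hπ (a * x)⁻¹ a (x : G ⧸ K)
  have e2 : (a * x)⁻¹ * a = x⁻¹ := by group
  rw [e2] at h
  rw [translateForm_mk hπ hq₀ x, h, e, translateForm_mk hπ hq₀]
  rfl

omit [FiniteDimensional ℝ E] in
theorem translateForm_one (hq₀ : ∀ a ∈ K,
      pullForm q₀ (tder F F (fun x : G ⧸ K => a • x) ((1 : G) : G ⧸ K)) = q₀) :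
    translateForm q₀ ((1 : G) : G ⧸ K) = q₀ := by
  rw [translateForm_mk hπ hq₀]
  simp only [inv_one, one_smul, tder_id]
  rfl

omit [FiniteDimensional ℝ E] in
theorem translateForm_pos (hpos : ∀ u, u ≠ 0 → 0 < q₀ u u) (q : G ⧸ K) {u : F} (hu : u ≠ 0) :
    0 < translateForm q₀ q u u := by
  refine hpos _ fun (h : tder F F (fun x : G ⧸ K => q.out⁻¹ • x) q u = 0) => hu ?_
  have h1 := tder_smul_inv_comp hπ q.out⁻¹ q
  have h2 := DFunLike.congr_fun h1 u
  rw [ContinuousLinearMap.comp_apply, h, map_zero] at h2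
  exact h2.symm

variable [IsManifold 𝓘(ℝ, F) ∞ (G ⧸ K)]

-- The choice `q.out` need not depend continuously on `q`. By `translateForm_mk` it can be replaced
-- near `p` by a smooth local section `σ`, and then the form is built from the derivative of the
-- smooth map `(q, r) ↦ σ(q)⁻¹ • r` in `r`.
omit [FiniteDimensional ℝ E] in
theorem contMDiffAt_translateForm (hq₀ : ∀ a ∈ K,
      pullForm q₀ (tder F F (fun x : G ⧸ K => a • x) ((1 : G) : G ⧸ K)) = q₀) (p : G ⧸ K) :
    ContMDiffAt 𝓘(ℝ, F) 𝓘(ℝ, F →L[ℝ] F →L[ℝ] ℝ) ∞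
      (fun q : G ⧸ K => pullForm (translateForm q₀ q)
        (tder F F (extChartAt 𝓘(ℝ, F) p).symm (extChartAt 𝓘(ℝ, F) p q))) p := by
  obtain ⟨x, rfl⟩ := QuotientGroup.mk_surjective p
  obtain ⟨σ, hσ, hσx, hπσ⟩ := exists_local_section hπ x
  have hf : ContMDiffAt (𝓘(ℝ, F).prod 𝓘(ℝ, F)) 𝓘(ℝ, F) ∞
      (fun r : (G ⧸ K) × (G ⧸ K) => (σ r.1)⁻¹ • r.2) ((x : G ⧸ K), (x : G ⧸ K)) :=
    ContMDiffAt.comp (g := fun r : G × (G ⧸ K) => r.1 • r.2)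
      (f := fun r : (G ⧸ K) × (G ⧸ K) => ((σ r.1)⁻¹, r.2)) _ (contMDiff_action hπ).contMDiffAt
      ((ContMDiffAt.comp ((x : G ⧸ K), (x : G ⧸ K)) hσ contMDiffAt_fst).inv.prodMk
        contMDiffAt_snd)
  have h := contMDiffAt_tder_param (f := fun q r : G ⧸ K => (σ q)⁻¹ • r) (g := fun q => q)
    (q₀ := (x : G ⧸ K)) hf contMDiffAt_id
  refine (ContMDiffAt.pullForm (b := fun _ => q₀) contMDiffAt_const h).congr_of_eventuallyEq ?_
  have eo : ∀ q : G ⧸ K, (σ q : G ⧸ K) = q → (σ q)⁻¹ • q = ((1 : G) : G ⧸ K) := by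
    intro q hq
    have h1 : (σ q)⁻¹ • q = (σ q)⁻¹ • (σ q : G ⧸ K) := by rw [hq]
    exact h1.trans (congrArg (QuotientGroup.mk : G → G ⧸ K) (inv_mul_cancel (σ q)))
  have eo0 := eo _ hπσ.self_of_nhds
  filter_upwards [hπσ] with q hq
  have e1 := eo q hq
  simp only [eo0, e1, tder_extChart_self, ContinuousLinearMap.id_comp]
  have e2 := translateForm_mk hπ hq₀ (σ q)
  rw [hq] at e2
  rw [e2]
  rfl

omit [FiniteDimensional ℝ E] in
/-- The invariant metric extending an invariant inner product at the origin. -/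
theorem exists_invariantMetric [FiniteDimensional ℝ F] (hsymm : ∀ u v, q₀ u v = q₀ v u)
    (hpos : ∀ u, u ≠ 0 → 0 < q₀ u u) (hq₀ : ∀ a ∈ K,
      pullForm q₀ (tder F F (fun x : G ⧸ K => a • x) ((1 : G) : G ⧸ K)) = q₀) :
    ∃ g : SmoothMetric F (G ⧸ K), IsInvariantMetric G g ∧ metForm g ((1 : G) : G ⧸ K) = q₀ := by
  refine ⟨{ inner := translateForm q₀
            symm := fun q u v => hsymm _ _
            pos := fun q u hu => translateForm_pos hπ hpos q hu
            isVonNBounded := fun q => isVonNBounded_of_pos (E := F) (B := translateForm q₀ q) fun u hu =>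
              translateForm_pos hπ hpos q hu
            contMDiff := fun q => (contMDiffAt_bilin_section_iff _ q).2
              (contMDiffAt_translateForm hπ hq₀ q) }, fun a q u v => ?_, ?_⟩
  · exact DFunLike.congr_fun (DFunLike.congr_fun (translateForm_smul hπ hq₀ a q) u) v
  · exact translateForm_one hπ hq₀

theorem existsUnique_isDeformedMetric (hb : IsBiInvariant b) (hKH : K ≤ H) (hlam : 0 < lam) :
    ∃! g : SmoothMetric F (G ⧸ K), IsDeformedMetric b K H lam g := by
  have hsurj := tder_submersion_surjective hπ 1
  obtain ⟨q₀, hq⟩ := exists_originForm (b := b) hKH hπ lam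
  have : FiniteDimensional ℝ F := FiniteDimensional.of_surjective
    (tder E F (QuotientGroup.mk : G → G ⧸ K) 1 : E →ₗ[ℝ] F) hsurj
  obtain ⟨g, hg, hgo⟩ := exists_invariantMetric hπ (q₀ := q₀)
    (fun u v => by
      obtain ⟨X, rfl⟩ := hsurj u
      obtain ⟨Y, rfl⟩ := hsurj v
      rw [hq, hq, deformedForm_symm])
    (fun u hu => by
      obtain ⟨X, rfl⟩ := hsurj u
      rw [hq]
      exact deformedForm_pos hlam (mt (tder_mk_eq_zero_iff hπ).2 hu))
    (fun a ha => by
      ext u v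
      obtain ⟨X, rfl⟩ := hsurj u
      obtain ⟨Y, rfl⟩ := hsurj v
      rw [pullForm_apply, tder_smul_mk_one hπ ha, tder_smul_mk_one hπ ha, hq, hq,
        deformedForm_Ad hb hKH lam ha])
  have hdef : IsDeformedMetric b K H lam g := by
    refine ⟨hg, fun (X₁ : E) h₁ (X₂ : E) h₂ (Y₁ : E) k₁ (Y₂ : E) k₂ => ?_⟩
    have h := (hq (X₁ + X₂) (Y₁ + Y₂)).trans (deformedForm_add hKH lam h₁ h₂ k₁ k₂)
    rw [← hgo] at h
    exact h
  exact ⟨g, hdef, fun g' hg' => hg'.unique hdef hKH hπ⟩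

end Existence

end DeformedMetric

end TwoStepGO

end

noncomputable section

namespace TwoStepGO

/-! ### Constant momenta imply the geodesic equation -/

section Noether

variable {F : Type*} [NormedAddCommGroup F] [NormedSpace ℝ F]

theorem fderiv_apply_zero_one {c : ℝ × ℝ → F} {s t : ℝ} (hc : DifferentiableAt ℝ c (s, t)) :
    fderiv ℝ c (s, t) (0, 1) = velocity F (fun τ => c (s, τ)) t := by
  have h : HasDerivAt (fun τ : ℝ => (s, τ)) ((0 : ℝ), (1 : ℝ)) t :=
    (hasDerivAt_const t s).prodMk (hasDerivAt_id t)
  rw [velocity_eq_deriv]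
  exact (hc.hasFDerivAt.comp_hasDerivAt t h).deriv.symm

theorem fderiv_apply_one_zero {c : ℝ × ℝ → F} {s t : ℝ} (hc : DifferentiableAt ℝ c (s, t)) :
    fderiv ℝ c (s, t) (1, 0) = velocity F (fun τ => c (τ, t)) s := by
  have h : HasDerivAt (fun τ : ℝ => (τ, t)) ((1 : ℝ), (0 : ℝ)) s :=
    (hasDerivAt_id s).prodMk (hasDerivAt_const s t)
  rw [velocity_eq_deriv]
  exact (hc.hasFDerivAt.comp_hasDerivAt s h).deriv.symm

variable {E : Type*} [NormedAddCommGroup E] [NormedSpace ℝ E] [FiniteDimensional ℝ E]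
  {G : Type*} [TopologicalSpace G] [T2Space G] [ChartedSpace E G] [Group G]
  [LieGroup 𝓘(ℝ, E) ∞ G] {K : Subgroup G} [ChartedSpace F (G ⧸ K)]
  (hπ : Manifold.IsSubmersion 𝓘(ℝ, E) 𝓘(ℝ, F) ∞ (QuotientGroup.mk : G → G ⧸ K))

include hπ

omit [FiniteDimensional ℝ E] [T2Space G] in
theorem mdifferentiableAt_orbit (a : G) (q : G ⧸ K) :
    MDifferentiableAt 𝓘(ℝ, E) 𝓘(ℝ, F) (fun a : G => a • q) a :=
  ((contMDiff_action hπ).comp (contMDiff_id.prodMk contMDiff_const)).mdifferentiableAt (by simp)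

-- The fundamental fields span every tangent space: at `xK` the translate of `dπ X` is realised by
-- `Ad(x)X`.
omit [FiniteDimensional ℝ E] [T2Space G] in
theorem tder_orbit_surjective (q : G ⧸ K) :
    Function.Surjective (tder E F (fun a : G => a • q) 1) := by
  obtain ⟨x, rfl⟩ := QuotientGroup.mk_surjective q
  intro v
  obtain ⟨u, rfl⟩ := tder_smul_surjective hπ x ((1 : G) : G ⧸ K) v
  obtain ⟨X, rfl⟩ := tder_submersion_surjective hπ 1 u
  refine ⟨Ad E x X, ?_⟩
  rw [tder_orbit hπ, Ad_inv_apply]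

variable [IsManifold 𝓘(ℝ, F) ∞ (G ⧸ K)] {g : SmoothMetric F (G ⧸ K)} {γ : ℝ → G ⧸ K}

/-- A curve in a homogeneous space whose momenta along all the fundamental vector fields are
constant is a geodesic. -/
theorem isGeodesicOn_of_momentum_const (hg : IsInvariantMetric G g)
    (hγ : ContMDiff 𝓘(ℝ, ℝ) 𝓘(ℝ, F) ∞ γ)
    (hmom : ∀ (Z : E) (t t' : ℝ),
      metForm g (γ t) (velocity F γ t) (tder E F (fun a : G => a • γ t) 1 Z)
        = metForm g (γ t') (velocity F γ t') (tder E F (fun a : G => a • γ t') 1 Z)) :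
    IsGeodesicOn g γ Set.univ := by
  refine ⟨hγ.contMDiffOn, fun t₀ _ p hp => ?_⟩
  intro c₀ w
  have hγd : ∀ t, MDifferentiableAt 𝓘(ℝ, ℝ) 𝓘(ℝ, F) γ t := fun t =>
    hγ.mdifferentiableAt (by simp)
  have hx : c₀ t₀ ∈ (extChartAt 𝓘(ℝ, F) p).target :=
    (extChartAt 𝓘(ℝ, F) p).map_source (by simpa using hp)
  -- The test vector `w` is realised as the value at `γ t₀` of a fundamental field, in coordinates.
  obtain ⟨Z, hZ⟩ : ∃ Z : E, tder F F (extChartAt 𝓘(ℝ, F) p) (γ t₀)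
      (tder E F (fun a : G => a • γ t₀) 1 Z) = w := by
    obtain ⟨Z, hZ⟩ := tder_orbit_surjective hπ (γ t₀)
      (tder F F (extChartAt 𝓘(ℝ, F) p).symm (c₀ t₀) w)
    refine ⟨Z, ?_⟩
    have h := DFunLike.congr_fun (tder_extChart_comp_symm hx) w
    rw [(extChartAt 𝓘(ℝ, F) p).left_inv (by simpa using hp)] at h
    rw [hZ]
    exact h
  set z : ℝ → G := fun s => lieExp (s • (Z : GroupLieAlgebra 𝓘(ℝ, E) G)) with hz
  have hz0 : z 0 = 1 := lieExp_zero_smul _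
  have hzs : ContMDiff 𝓘(ℝ, ℝ) 𝓘(ℝ, E) ∞ z := contMDiff_lieExp_smul _
  have hzv : velocity E z 0 = Z := velocity_lieExp_zero _
  -- The variation `exp(sZ) • γ(t)` in the chart; its variation field at `s = 0` is the fundamental
  -- field of `Z`.
  set c : ℝ × ℝ → F := fun r => extChartAt 𝓘(ℝ, F) p (z r.1 • γ r.2) with hc
  have hcs : ∀ s t, z s • γ t ∈ (chartAt F p).source → ContDiffAt ℝ ∞ c (s, t) := by
    intro s t hst
    rw [← contMDiffAt_iff_contDiffAt]
    have h1 : ContMDiff 𝓘(ℝ, ℝ × ℝ) (𝓘(ℝ, E).prod 𝓘(ℝ, F)) ∞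
        (fun r : ℝ × ℝ => (z r.1, γ r.2)) :=
      (hzs.comp contDiff_fst.contMDiff).prodMk (hγ.comp contDiff_snd.contMDiff)
    have h2 := (contMDiff_action hπ).comp h1
    exact ContMDiffAt.comp_of_eq (contMDiffAt_extChart hst) (h2 (s, t)) rfl
  have hdt : ∀ s t, z s • γ t ∈ (chartAt F p).source → fderiv ℝ c (s, t) (0, 1)
      = tder F F (extChartAt 𝓘(ℝ, F) p) (z s • γ t)
        (tder F F (fun q : G ⧸ K => z s • q) (γ t) (velocity F γ t)) := by
    intro s t hst
    rw [fderiv_apply_zero_one ((hcs s t hst).differentiableAt (by simp)),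
      ← velocity_comp (mdifferentiableAt_smul_left hπ (z s) (γ t)) (hγd t) rfl]
    exact velocity_comp (γ := fun τ => z s • γ τ)
      ((contMDiffAt_extChart hst).mdifferentiableAt (by simp))
      (((contMDiff_smul_left hπ (z s)).comp hγ).mdifferentiableAt (by simp)) rfl
  have hds : ∀ t, γ t ∈ (chartAt F p).source → fderiv ℝ c (0, t) (1, 0)
      = tder F F (extChartAt 𝓘(ℝ, F) p) (γ t) (tder E F (fun a : G => a • γ t) 1 Z) := by
    intro t ht
    have ht' : z 0 • γ t ∈ (chartAt F p).source := by rwa [hz0, one_smul]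
    have hzd : MDifferentiableAt 𝓘(ℝ, ℝ) 𝓘(ℝ, E) z 0 := hzs.mdifferentiableAt (by simp)
    have e := velocity_comp (mdifferentiableAt_orbit hπ 1 (γ t)) hzd hz0
    rw [hzv] at e
    rw [fderiv_apply_one_zero ((hcs 0 t ht').differentiableAt (by simp)), ← e]
    refine velocity_comp (γ := fun τ => z τ • γ t)
      ((contMDiffAt_extChart ht).mdifferentiableAt (by simp)) ?_ (by simp only [hz0, one_smul])
    exact MDifferentiableAt.comp (g := fun a : G => a • γ t) 0
      (mdifferentiableAt_orbit hπ (z 0) (γ t)) hzd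
  have hc0 : ∀ t, c (0, t) = c₀ t := fun t => by
    simp only [hc, hz0, one_smul]; rfl
  have hp' : z 0 • γ t₀ ∈ (chartAt F p).source := by rwa [hz0, one_smul]
  have hdt0 : ∀ t, γ t ∈ (chartAt F p).source → fderiv ℝ c (0, t) (0, 1)
      = tder F F (extChartAt 𝓘(ℝ, F) p) (γ t) (velocity F γ t) := by
    intro t ht
    rw [hdt 0 t (by rwa [hz0, one_smul]), hz0]
    simp only [one_smul, tder_id]
    rfl
  -- Translation by `z s` is an isometry, so the speed at `t₀` is the same for all `s`.
  have hspeed : ∀ s, z s • γ t₀ ∈ (chartAt F p).source →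
      chartForm g p (c (s, t₀)) (fderiv ℝ c (s, t₀) (0, 1)) (fderiv ℝ c (s, t₀) (0, 1))
        = metForm g (γ t₀) (velocity F γ t₀) (velocity F γ t₀) := by
    intro s hs
    rw [hdt s t₀ hs, ← hg.metForm_smul (z s)]
    exact chartForm_extChart g hs _ _
  have hmomc : ∀ t, γ t ∈ (chartAt F p).source →
      chartForm g p (c (0, t)) (fderiv ℝ c (0, t) (0, 1)) (fderiv ℝ c (0, t) (1, 0))
        = metForm g (γ t) (velocity F γ t) (tder E F (fun a : G => a • γ t) 1 Z) := by
    intro t ht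
    rw [hdt0 t ht, hds t ht, hc0]
    exact chartForm_extChart g ht _ _
  have key := first_variation (h := chartForm g p) (c := c) (t₀ := t₀) (chartForm_symm g p)
    (by
      rw [hc0]
      exact (contDiffAt_chartForm g hx).differentiableAt (by simp))
    ((hcs 0 t₀ hp').of_le (by norm_cast))
    (by
      have hcont : Continuous (fun s => z s • γ t₀) :=
        ((contMDiff_action hπ).comp (hzs.prodMk contMDiff_const)).continuous
      filter_upwards [hcont.continuousAt.preimage_mem_nhds
        ((chartAt F p).open_source.mem_nhds hp')] with s hs
      rw [hspeed s hs, hspeed 0 hp'])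
    (by
      filter_upwards [hγ.continuous.continuousAt.preimage_mem_nhds
        ((chartAt F p).open_source.mem_nhds hp)] with t ht
      rw [hmomc t ht, hmomc t₀ hp]
      exact hmom Z t t₀)
  have hd : deriv c₀ t₀ = fderiv ℝ c (0, t₀) (0, 1) := by
    rw [fderiv_apply_zero_one ((hcs 0 t₀ hp').differentiableAt (by simp)), velocity_eq_deriv]
    exact congrArg (fun f => deriv f t₀) (funext hc0).symm
  have hcc : (fun t => c (0, t)) = c₀ := funext hc0
  rw [hds t₀ hp, hZ, hcc, hc0, ← hd] at key
  show chartMetric g p (c₀ t₀) (deriv (deriv c₀) t₀) w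
    + chartChristoffel g p (c₀ t₀) (deriv c₀ t₀) w = 0
  rw [chartMetric_eq, chartChristoffel_eq g hx]
  exact key

end Noether

end TwoStepGO

end

noncomputable section

namespace TwoStepGO

/-! ### The two-step curves are the geodesics -/

section TwoStep

variable {E : Type*} [NormedAddCommGroup E] [NormedSpace ℝ E] [FiniteDimensional ℝ E]
  {G : Type*} [TopologicalSpace G] [T2Space G] [ChartedSpace E G] [Group G]
  [LieGroup 𝓘(ℝ, E) ∞ G] {b : SmoothMetric E G} {K H : Subgroup G}
  {F : Type*} [NormedAddCommGroup F] [NormedSpace ℝ F] [ChartedSpace F (G ⧸ K)]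

/-- The left logarithmic derivative of `t ↦ exp(tA) exp(tC)`, where `d = exp(tC)`. -/
def leftLogDeriv (A C : E) (d : G) : E := Ad E d⁻¹ A + C

omit [FiniteDimensional ℝ E] [T2Space G] [LieGroup 𝓘(ℝ, E) ∞ G] in
theorem leftLogDeriv_one (A C : E) : leftLogDeriv A C (1 : G) = A + C := by
  rw [leftLogDeriv, inv_one, Ad_one]
  rfl

/-- The derivative of `t ↦ exp(tA) exp(tC)`. -/
theorem velocity_lieExp_mul_lieExp (A C : GroupLieAlgebra 𝓘(ℝ, E) G) (t : ℝ) :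
    velocity E (fun t : ℝ => lieExp (t • A) * lieExp (t • C)) t
      = tder E E (fun y : G => lieExp (t • A) * lieExp (t • C) * y) 1
        (leftLogDeriv A C (lieExp (t • C))) := by
  have hm : MDifferentiableAt (𝓘(ℝ, E).prod 𝓘(ℝ, E)) 𝓘(ℝ, E) (fun p : G × G => p.1 * p.2)
      (lieExp (t • A), lieExp (t • C)) :=
    (contMDiff_mul 𝓘(ℝ, E) ∞).mdifferentiableAt (by simp)
  have key := velocity_comp₂ (f := fun x y : G => x * y) (c := fun t => lieExp (t • A))
    (d := fun t => lieExp (t • C)) hm (mdifferentiableAt_lieExp_smul A t)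
    (mdifferentiableAt_lieExp_smul C t)
  rw [velocity_lieExp_smul, velocity_lieExp_smul] at key
  refine key.trans (Eq.trans ?_ (map_add
    (tder E E (fun y : G => lieExp (t • A) * lieExp (t • C) * y) 1)
    (Ad E (lieExp (t • C))⁻¹ A) (C : E)).symm)
  set c : G := lieExp (t • A)
  set d : G := lieExp (t • C)
  refine congrArg₂ (· + ·) ?_ ?_
  -- Moving `d` to the left costs a conjugation: `c y d = (c d)(d⁻¹ y d)`.
  · have h1 := tder_comp (mdifferentiableAt_mul_right (E := E) d c)
      (mdifferentiableAt_mul_left (E := E) c 1) (mul_one c)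
    have h2 := tder_comp (mdifferentiableAt_mul_left (E := E) (c * d) 1)
      (mdifferentiableAt_conj E d⁻¹ 1) (by simp)
    have e : (fun y : G => c * d * (d⁻¹ * y * d⁻¹⁻¹)) = fun y => c * y * d := by
      funext y; group
    rw [e, h1] at h2
    exact DFunLike.congr_fun h2 A
  · have h1 := tder_comp (mdifferentiableAt_mul_left (E := E) c d)
      (mdifferentiableAt_mul_left (E := E) d 1) (mul_one d)
    simp only [← mul_assoc] at h1
    exact (DFunLike.congr_fun h1 C).symm

omit [T2Space G] [LieGroup 𝓘(ℝ, E) ∞ G] [FiniteDimensional ℝ E] in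
theorem twoStepCurve_eq (A C : GroupLieAlgebra 𝓘(ℝ, E) G) (t : ℝ) :
    twoStepCurve K A C t = ((lieExp (t • A) * lieExp (t • C) : G) : G ⧸ K) :=
  congrArg (QuotientGroup.mk : G → G ⧸ K) (mul_one _)

theorem twoStepCurve_zero (A C : GroupLieAlgebra 𝓘(ℝ, E) G) :
    twoStepCurve K A C 0 = ((1 : G) : G ⧸ K) := by
  rw [twoStepCurve_eq, lieExp_zero_smul, lieExp_zero_smul, mul_one]

theorem contMDiff_twoStepCurve
    (hπ : Manifold.IsSubmersion 𝓘(ℝ, E) 𝓘(ℝ, F) ∞ (QuotientGroup.mk : G → G ⧸ K))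
    (A C : GroupLieAlgebra 𝓘(ℝ, E) G) : ContMDiff 𝓘(ℝ, ℝ) 𝓘(ℝ, F) ∞ (twoStepCurve K A C) := by
  rw [show twoStepCurve K A C = fun t => ((lieExp (t • A) * lieExp (t • C) : G) : G ⧸ K) from
    funext (twoStepCurve_eq A C)]
  exact hπ.contMDiff.comp ((contMDiff_lieExp_smul A).mul (contMDiff_lieExp_smul C))

theorem velocity_twoStepCurve
    (hπ : Manifold.IsSubmersion 𝓘(ℝ, E) 𝓘(ℝ, F) ∞ (QuotientGroup.mk : G → G ⧸ K))
    (A C : GroupLieAlgebra 𝓘(ℝ, E) G) (t : ℝ) :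
    velocity F (twoStepCurve K A C) t
      = tder F F (fun q : G ⧸ K => (lieExp (t • A) * lieExp (t • C)) • q) ((1 : G) : G ⧸ K)
        (tder E F (QuotientGroup.mk : G → G ⧸ K) 1 (leftLogDeriv A C (lieExp (t • C)))) := by
  rw [show twoStepCurve K A C = fun t => ((lieExp (t • A) * lieExp (t • C) : G) : G ⧸ K) from
    funext (twoStepCurve_eq A C),
    velocity_comp (γ := fun t => lieExp (t • A) * lieExp (t • C)) (mdifferentiableAt_mk hπ _)
    (((contMDiff_lieExp_smul A).mul (contMDiff_lieExp_smul C)).mdifferentiableAt (by simp)) rfl,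
    velocity_lieExp_mul_lieExp]
  set a : G := lieExp (t • A) * lieExp (t • C)
  have h1 := tder_comp (mdifferentiableAt_mk hπ a) (mdifferentiableAt_mul_left (E := E) a 1)
    (mul_one a)
  have h2 := tder_comp (mdifferentiableAt_smul_left hπ a ((1 : G) : G ⧸ K))
    (mdifferentiableAt_mk hπ 1) rfl
  exact DFunLike.congr_fun (h1.symm.trans h2) _

-- Orthogonality of `𝔪₁`, `𝔪₂` and `𝔨` lets the projections of `Y` be replaced by `Y` itself, so the
-- deformation becomes the factor `λ` on `X₂`.
omit [T2Space G] in
theorem deformedForm_left (hKH : K ≤ H) (lam : ℝ) {X₁ X₂ : E}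
    (h₁ : X₁ ∈ (mOne b H : Submodule ℝ E)) (h₂ : X₂ ∈ (mTwo b K H : Submodule ℝ E)) (Y : E) :
    deformedForm b K H lam (X₁ + X₂) Y = metForm b 1 (X₁ + lam • X₂) Y := by
  have k₁ : metForm b 1 X₁ (projLie b H Y) = 0 := mem_orthCompl.1 h₁ _ (projLie_mem Y)
  have k₂ : metForm b 1 X₂ (projLie b K Y) = 0 := mem_orthCompl.1 h₂.2 _ (projLie_mem Y)
  have k₃ : metForm b 1 X₂ (projLie b H Y) = metForm b 1 X₂ Y := by
    rw [metForm_symm, projLie_spec Y h₂.1, metForm_symm]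
  rw [deformedForm_apply, projOne_add hKH h₁ h₂, projTwo_add hKH h₁ h₂]
  have e₁ : projOne b H Y = Y - projLie b H Y := rfl
  have e₂ : projTwo b K H Y = projLie b H Y - projLie b K Y := rfl
  rw [e₁, e₂, map_sub, map_sub, k₁, k₂, k₃, map_add, map_smul]
  simp

-- The weights are chosen so that `λX₂ + (1-λ)X₂ = X₂`: the logarithmic derivative is `Ad(d⁻¹)X₁ +
-- X₂`, and the deformed form multiplies its `𝔪₂` part by `λ`, giving back `Ad(d⁻¹)` of the first
-- generator.
omit [T2Space G] in
theorem deformedForm_leftLogDeriv (hKH : K ≤ H) (lam : ℝ) {X₁ X₂ : E} {d : G}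
    (h₁ : Ad E d⁻¹ X₁ ∈ (mOne b H : Submodule ℝ E)) (h₂ : X₂ ∈ (mTwo b K H : Submodule ℝ E))
    (hd : Ad E d⁻¹ X₂ = X₂) (Y : E) :
    deformedForm b K H lam (leftLogDeriv (X₁ + lam • X₂) ((1 - lam) • X₂) d) Y
      = metForm b 1 (Ad E d⁻¹ (X₁ + lam • X₂)) Y := by
  have h : leftLogDeriv (X₁ + lam • X₂) ((1 - lam) • X₂) d = Ad E d⁻¹ X₁ + X₂ := by
    rw [leftLogDeriv, map_add, map_smul, hd]
    module
  rw [h, deformedForm_left hKH lam h₁ h₂, map_add (Ad E d⁻¹), map_smul (Ad E d⁻¹), hd]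

variable [IsManifold 𝓘(ℝ, F) ∞ (G ⧸ K)] {lam : ℝ} {g : SmoothMetric F (G ⧸ K)}

/-- Translating back to the origin turns the momentum into the deformed form of the logarithmic
derivative and `Ad((cd)⁻¹)Z`; invariance of `B` then removes `d` and `c`, leaving a value without
`t`. -/
theorem IsDeformedMetric.momentum_twoStepCurve (hg : IsDeformedMetric b K H lam g)
    (hb : IsBiInvariant b) (hKH : K ≤ H)
    (hπ : Manifold.IsSubmersion 𝓘(ℝ, E) 𝓘(ℝ, F) ∞ (QuotientGroup.mk : G → G ⧸ K))
    {X₁ X₂ : GroupLieAlgebra 𝓘(ℝ, E) G} (h₁ : X₁ ∈ mOne b H) (h₂ : X₂ ∈ mTwo b K H) (Z : E)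
    (t : ℝ) :
    metForm g (twoStepCurve K (X₁ + lam • X₂) ((1 - lam) • X₂) t)
      (velocity F (twoStepCurve K (X₁ + lam • X₂) ((1 - lam) • X₂)) t)
      (tder E F (fun a : G => a • twoStepCurve K (X₁ + lam • X₂) ((1 - lam) • X₂) t) 1 Z)
      = metForm b 1 (X₁ + lam • X₂ : E) Z := by
  set A : GroupLieAlgebra 𝓘(ℝ, E) G := X₁ + lam • X₂ with hA
  set C : GroupLieAlgebra 𝓘(ℝ, E) G := (1 - lam) • X₂ with hC
  have e : (lieExp (t • A) * lieExp (t • C)) • ((1 : G) : G ⧸ K)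
      = ((lieExp (t • A) * lieExp (t • C) : G) : G ⧸ K) :=
    congrArg (QuotientGroup.mk : G → G ⧸ K) (mul_one _)
  rw [velocity_twoStepCurve hπ, twoStepCurve_eq, tder_orbit hπ, ← e, hg.1.metForm_smul,
    hg.metForm_origin hKH hπ]
  set c : G := lieExp (t • A) with hc
  set d : G := lieExp (t • C) with hd
  have hCH : C ∈ lieAlgebraOf H := Submodule.smul_mem _ _ h₂.1
  have hd' : d⁻¹ = lieExp ((-t) • C) := (lieExp_neg_smul C t).symm
  have hX₁ : Ad E d⁻¹ X₁ ∈ (mOne b H : Submodule ℝ E) := by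
    rw [hd']
    exact Ad_lieExp_mem_orthCompl hb hCH h₁ _
  have hX₂ : Ad E d⁻¹ X₂ = X₂ := by
    rw [hd', hC, smul_smul]
    exact Ad_lieExp_self X₂ _
  refine (deformedForm_leftLogDeriv hKH lam hX₁ h₂ hX₂ _).trans ?_
  -- `Ad(c)` fixes `A`, as `c` lies on the one-parameter subgroup of `A`.
  refine Eq.trans ?_ (congrArg (fun Y : E => metForm b 1 Y Z) (Ad_lieExp_self A t))
  rw [mul_inv_rev, Ad_mul_apply, hb.metForm_Ad]
  exact (hb.metForm_Ad_left c (A : E) Z).symm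

theorem IsDeformedMetric.isGeodesicOn_twoStepCurve (hg : IsDeformedMetric b K H lam g)
    (hb : IsBiInvariant b) (hKH : K ≤ H)
    (hπ : Manifold.IsSubmersion 𝓘(ℝ, E) 𝓘(ℝ, F) ∞ (QuotientGroup.mk : G → G ⧸ K))
    {X₁ X₂ : GroupLieAlgebra 𝓘(ℝ, E) G} (h₁ : X₁ ∈ mOne b H) (h₂ : X₂ ∈ mTwo b K H) :
    IsGeodesicOn g (twoStepCurve K (X₁ + lam • X₂) ((1 - lam) • X₂)) Set.univ :=
  isGeodesicOn_of_momentum_const hπ hg.1 (contMDiff_twoStepCurve hπ _ _) fun Z t t' => by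
    rw [hg.momentum_twoStepCurve hb hKH hπ h₁ h₂, hg.momentum_twoStepCurve hb hKH hπ h₁ h₂]

omit [IsManifold 𝓘(ℝ, F) ∞ (G ⧸ K)] in
theorem velocity_twoStepCurve_zero
    (hπ : Manifold.IsSubmersion 𝓘(ℝ, E) 𝓘(ℝ, F) ∞ (QuotientGroup.mk : G → G ⧸ K))
    (X₁ X₂ : GroupLieAlgebra 𝓘(ℝ, E) G) (lam : ℝ) :
    velocity F (twoStepCurve K (X₁ + lam • X₂) ((1 - lam) • X₂)) 0
      = dProj F K (X₁ + X₂) := by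
  rw [velocity_twoStepCurve hπ, lieExp_zero_smul, lieExp_zero_smul]
  simp only [mul_one, one_smul, tder_id]
  refine congrArg (tder E F (QuotientGroup.mk : G → G ⧸ K) 1)
    ((leftLogDeriv_one (E := E) _ _).trans ?_)
  show (X₁ : E) + lam • (X₂ : E) + (1 - lam) • (X₂ : E) = (X₁ : E) + X₂
  module

/-- Both curves are geodesics with the same initial data. Closedness of `K` enters here, making
`G/K` Hausdorff as `IsGeodesicOn.eqOn` requires. -/
theorem IsDeformedMetric.eq_twoStepCurve [FiniteDimensional ℝ F]
    (hg : IsDeformedMetric b K H lam g) (hb : IsBiInvariant b) (hKc : IsClosed (K : Set G))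
    (hKH : K ≤ H)
    (hπ : Manifold.IsSubmersion 𝓘(ℝ, E) 𝓘(ℝ, F) ∞ (QuotientGroup.mk : G → G ⧸ K))
    {X₁ X₂ : GroupLieAlgebra 𝓘(ℝ, E) G} (h₁ : X₁ ∈ mOne b H) (h₂ : X₂ ∈ mTwo b K H)
    {J : Set ℝ} {γ : ℝ → G ⧸ K} (hJ : IsOpen J) (hJc : J.OrdConnected) (h0 : (0 : ℝ) ∈ J)
    (hγ : IsGeodesicOn g γ J) (hγ0 : γ 0 = QuotientGroup.mk 1)
    (hv : velocity F γ 0 = dProj F K (X₁ + X₂)) :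
    ∀ t ∈ J, γ t = twoStepCurve K (X₁ + lam • X₂) ((1 - lam) • X₂) t := by
  have : IsTopologicalGroup G := topologicalGroup_of_lieGroup 𝓘(ℝ, E) ∞
  have : T2Space (G ⧸ K) := t2Space_quotient hKc
  exact hγ.eqOn ((hg.isGeodesicOn_twoStepCurve hb hKH hπ h₁ h₂).mono (Set.subset_univ J)) hJ hJc h0
    (hγ0.trans (twoStepCurve_zero _ _).symm) (hv.trans (velocity_twoStepCurve_zero hπ X₁ X₂ lam).symm)

theorem IsDeformedMetric.isTwoStepGOSpace [FiniteDimensional ℝ F]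
    (hg : IsDeformedMetric b K H lam g) (hb : IsBiInvariant b) (hKc : IsClosed (K : Set G))
    (hKH : K ≤ H)
    (hπ : Manifold.IsSubmersion 𝓘(ℝ, E) 𝓘(ℝ, F) ∞ (QuotientGroup.mk : G → G ⧸ K)) :
    IsTwoStepGOSpace E K g := by
  intro J γ hJ hJc h0 hγ hγ0
  obtain ⟨X, ⟨h₁, h₂, hX⟩, _⟩ := existsUnique_decomposition (b := b) hKH hπ (velocity F γ 0)
  exact ⟨_, _, hg.eq_twoStepCurve hb hKc hKH hπ h₁ h₂ hJ hJc h0 hγ hγ0 hX.symm⟩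

end TwoStep

end TwoStepGO

end

theorem mainTheorem1
    {E : Type*} [NormedAddCommGroup E] [NormedSpace ℝ E] [FiniteDimensional ℝ E]
    {G : Type*} [TopologicalSpace G] [T2Space G] [ChartedSpace E G] [Group G]
    [LieGroup 𝓘(ℝ, E) ∞ G]
    -- a bi-invariant Riemannian metric on `G`, with inner product `B = b.inner 1` on `𝔤`
    (b : TwoStepGO.SmoothMetric E G) (hb : TwoStepGO.IsBiInvariant b)
    -- closed connected subgroups `K ⊆ H` of `G`
    (K H : Subgroup G) (hKc : IsClosed (K : Set G)) (hHc : IsClosed (H : Set G))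
    (hKconn : IsConnected (K : Set G)) (hHconn : IsConnected (H : Set G)) (hKH : K ≤ H)
    -- the manifold structure of `G/K`: the one for which the projection is a smooth submersion
    {E' : Type*} [NormedAddCommGroup E'] [NormedSpace ℝ E'] [FiniteDimensional ℝ E']
    [ChartedSpace E' (G ⧸ K)] [IsManifold 𝓘(ℝ, E') ∞ (G ⧸ K)]
    (hπ : Manifold.IsSubmersion 𝓘(ℝ, E) 𝓘(ℝ, E') ∞ (QuotientGroup.mk : G → G ⧸ K))
    (lam : ℝ) (hlam : 0 < lam) :
    (∃! g : TwoStepGO.SmoothMetric E' (G ⧸ K), TwoStepGO.IsDeformedMetric b K H lam g) ∧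
    ∀ g : TwoStepGO.SmoothMetric E' (G ⧸ K), TwoStepGO.IsDeformedMetric b K H lam g →
      TwoStepGO.IsTwoStepGOSpace E K g ∧
      -- every initial velocity is `X₁ + X₂` for a unique pair
      (∀ v : TangentSpace 𝓘(ℝ, E') (QuotientGroup.mk 1 : G ⧸ K),
        ∃! X : GroupLieAlgebra 𝓘(ℝ, E) G × GroupLieAlgebra 𝓘(ℝ, E) G,
          X.1 ∈ TwoStepGO.mOne b H ∧ X.2 ∈ TwoStepGO.mTwo b K H ∧
            TwoStepGO.dProj E' K (X.1 + X.2) = v) ∧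
      ∀ X₁ ∈ TwoStepGO.mOne b H, ∀ X₂ ∈ TwoStepGO.mTwo b K H,
        -- the explicit curve is a complete geodesic with initial velocity `X₁ + X₂`
        (TwoStepGO.IsGeodesicOn g
            (TwoStepGO.twoStepCurve K (X₁ + lam • X₂) ((1 - lam) • X₂)) Set.univ ∧
          TwoStepGO.twoStepCurve K (X₁ + lam • X₂) ((1 - lam) • X₂) 0 = QuotientGroup.mk 1 ∧
          TwoStepGO.velocity E'
            (TwoStepGO.twoStepCurve K (X₁ + lam • X₂) ((1 - lam) • X₂)) 0
              = TwoStepGO.dProj E' K (X₁ + X₂)) ∧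
        -- every geodesic through `o` with this initial velocity is that curve
        ∀ (J : Set ℝ) (γ : ℝ → G ⧸ K), IsOpen J → J.OrdConnected → (0 : ℝ) ∈ J →
          TwoStepGO.IsGeodesicOn g γ J → γ 0 = QuotientGroup.mk 1 →
          TwoStepGO.velocity E' γ 0 = TwoStepGO.dProj E' K (X₁ + X₂) →
          ∀ t ∈ J, γ t = TwoStepGO.twoStepCurve K (X₁ + lam • X₂) ((1 - lam) • X₂) t := by
  refine ⟨TwoStepGO.existsUnique_isDeformedMetric hπ hb hKH hlam, fun g hg =>
    ⟨hg.isTwoStepGOSpace hb hKc hKH hπ, TwoStepGO.existsUnique_decomposition (E := E) (F := E') hKH hπ,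
      fun X₁ h₁ X₂ h₂ => ⟨⟨hg.isGeodesicOn_twoStepCurve hb hKH hπ h₁ h₂,
        TwoStepGO.twoStepCurve_zero _ _, TwoStepGO.velocity_twoStepCurve_zero hπ X₁ X₂ lam⟩,
        fun J γ hJ hJc h0 hγ hγ0 hv =>
          hg.eq_twoStepCurve hb hKc hKH hπ h₁ h₂ hJ hJc h0 hγ hγ0 hv⟩⟩⟩
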